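/- Let $m\ge 2$, and let $U_1,U_2,\dots$ be real random keys on a probability space that follow the random permutation model: for every $n$, the relative order of $U_1,\dots,U_n$ is a uniformly random permutation (each of the $n!$ strict orders has probability $1/n!$; for example, independent keys with a common continuous distribution). Insert the keys one after the other into an initially empty $m$-ary search tree: a node holds at most $m-1$ keys in sorted order; a node that is not full takes the next key that reaches it; and a full node with sorted keys $k_1<\dots<k_{m-1}$ sends a key $x$ to its $i$-th subtree ($1\le i\le m$) when $k_{i-1}\le x<k_i$, where $k_0=-\infty$ and $k_m=\infty$. Gaps are insertion positions for the next key and have types $1,\dots,2m-2$: * if a node with $m-1$ keys has exactly $i\ge 1$ empty subtrees, then these are $i$ gaps of type $i$ ($1\le i\le m$; a leaf with $m-1$ keys is the case $i=m$); * a leaf with $i-1$ keys, $2\le i\le m-1$, has $i$ gaps, all of type $m+i-1$. Let $X_n^{(i)}$ be the number of gaps of type $i$ in the tree after $n$ insertions, and $\mathbf X_n=(X_n^{(1)},\dots,X_n^{(2m-2)})$. Let $\mathbf A$ be the $(2m-2)\times(2m-2)$ replacement matrix, whose $(i,j)$ entry is the change in the number of gaps of type $j$ when a key is inserted into a gap of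 type $i$: for $1\le i\le m$, remove $i$ gaps of type $i$, add $i-1$ gaps of type $i-1$ (none if $i=1$) and two gaps of type $m+1$ (of type $2$ if $m=2$); for $2\le i\le m-2$, a gap of type $m+i-1$ leads to the removal of $i$ gaps of type $m+i-1$ and the addition of $i+1$ gaps of type $m+i$; and, if $m\ge 3$, a gap of type $2m-2$ leads to the removal of $m-1$ gaps of type $2m-2$ and the addition of $m$ gaps of type $m$. With $H_m=\sum_{k=1}^m 1/k$, let $$\mathbf v=\frac{1}{m(m+1)(H_m-1)}\Bigl(1,2,\dots,m,\tfrac13m(m+1),\tfrac14m(m+1),\dots,\tfrac1m m(m+1)\Bigr)^T\in\mathbb R^{2m-2}.$$ Then $\mathbf v$ is the principal eigenvector of $\mathbf A^T$, normalized to have component sum $1$: one has $\mathbf A^T\mathbf v=\mathbf v$ and $\sum_{i=1}^{2m-2}v_i=1$, every real solution $\mathbf w$ of $\mathbf A^T\mathbf w=\mathbf w$ is a multiple of $\mathbf v$, and every complex eigenvalue $\mu\neq1$ of $\mathbf A^T$ satisfies $\operatorname{Re}\mu<1$. Moreover, $$\frac1n\,\mathbf X_n\longrightarrow\mathbf v\qquad\text{almost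 surely, component by component, as } n\to\infty .$$ -/

import Mathlib

open MeasureTheory Filter Topology ProbabilityTheory

/-- `m`-ary trees: a tree is empty, or has a root holding a list of keys and `m` ordered
subtrees (all of them empty as long as the root is not full). -/
inductive MaryTree (m : ℕ) (α : Type*) where
  | empty : MaryTree m α
  | node (keys : List α) (children : Fin m → MaryTree m α) : MaryTree m α

namespace MaryTree

variable {m : ℕ} {α : Type*}

/-- Whether a tree is empty (a **nil** pointer). -/
def isEmpty : MaryTree m α → Bool
  | empty => true
  | node _ _ => false

/-- Insertion of a key into an `m`-ary search tree. A node that holds fewer than `m - 1` keys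
takes the key, at its sorted place. A full node with sorted keys `k₁ ≤ … ≤ k_{m-1}` directs the
key `x` to its subtree number `i` (`0 ≤ i ≤ m - 1`) with `kᵢ ≤ x < kᵢ₊₁`, where `k₀ = -∞` and
`k_m = ∞`; that is, `i` is the number of keys of the node that are at most `x`. -/
def insertKey [LinearOrder α] (x : α) : MaryTree m α → MaryTree m α
  | empty => node [x] fun _ => empty
  | node keys children =>
    if keys.length < m - 1 then node (keys.orderedInsert (· ≤ ·) x) children
    else node keys fun i =>
      if (i : ℕ) = keys.countP (fun k => decide (k ≤ x)) then insertKey x (children i)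
      else children i

/-- The `m`-ary search tree after the insertion of the first `n` keys of the sequence `x`. -/
def grow [LinearOrder α] (m : ℕ) (x : ℕ → α) : ℕ → MaryTree m α
  | 0 => empty
  | n + 1 => insertKey (x n) (grow m x n)

/-- The number of gaps (insertion positions) of type `i` in an `m`-ary search tree.
A leaf with `k` keys, `1 ≤ k ≤ m - 2`, has `k + 1` gaps, all of type `m + k`.
A node with `m - 1` keys has one gap for each of its empty subtrees; if there are `g` of these,
they are gaps of type `g` (in particular a leaf with `m - 1` keys has `m` gaps of type `m`). -/
def gapCount : MaryTree m α → ℕ → ℕ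
  | empty, _ => 0
  | node keys children, i =>
    if keys.length < m - 1 then (if i = m + keys.length then keys.length + 1 else 0)
    else
      (if i = (Finset.univ.filter fun j => (children j).isEmpty = true).card then i else 0)
        + ∑ j, gapCount (children j) i

end MaryTree

/-- The type (color) of the gaps of a leaf with `k` keys, `1 ≤ k ≤ m - 1`. -/
def leafColor (m k : ℕ) : ℕ := if k = m - 1 then m else m + k

/-- The number of balls of color `j` that are added to the urn (removed, if negative) when a
ball of color `i` is picked, `1 ≤ i, j ≤ 2m - 2`.
Color `i ≤ m`: remove `i` balls of color `i`, add `i - 1` balls of color `i - 1` and the two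
gaps of a new leaf with one key.
Color `i = m + k`: the `k + 1` gaps of a leaf with `k` keys are replaced by the `k + 2` gaps of
a leaf with `k + 1` keys. -/
def replacementEntry (m i j : ℕ) : ℤ :=
  if i ≤ m then
    (if j = i then -(i : ℤ) else 0) + (if j + 1 = i then (i : ℤ) - 1 else 0)
      + (if j = leafColor m 1 then 2 else 0)
  else
    (if j = i then -((i : ℤ) - m + 1) else 0)
      + (if j = leafColor m (i - m + 1) then (i : ℤ) - m + 2 else 0)

/-- The replacement matrix of the urn; the index `i : Fin (2 * m - 2)` stands for the
color `i + 1`. -/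
def replacementMatrix (m : ℕ) : Matrix (Fin (2 * m - 2)) (Fin (2 * m - 2)) ℝ :=
  Matrix.of fun i j => (replacementEntry m (i + 1) (j + 1) : ℝ)

/-- `ρ` is the principal eigenvalue of the real matrix `M` (all other complex eigenvalues have a
smaller real part), and `v` is an eigenvector for `ρ`, unique up to a scalar factor. -/
def IsPrincipalEigenvector {ι : Type*} [Fintype ι] [DecidableEq ι]
    (M : Matrix ι ι ℝ) (ρ : ℝ) (v : ι → ℝ) : Prop :=
  v ≠ 0 ∧ M.mulVec v = ρ • v ∧
    (∀ w : ι → ℝ, M.mulVec w = ρ • w → ∃ c : ℝ, w = c • v) ∧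
    ∀ μ : ℂ, Module.End.HasEigenvalue (Matrix.toLin' (M.map (fun a : ℝ => (a : ℂ)))) μ →
      μ ≠ (ρ : ℂ) → μ.re < ρ

/-- The vector with the components `c` for `1 ≤ c ≤ m` and `m (m + 1) / (c - m + 2)` for
`m + 1 ≤ c ≤ 2m - 2`, all divided by `m (m + 1) (H_m - 1)`. -/
noncomputable def limitVector (m : ℕ) : Fin (2 * m - 2) → ℝ := fun i =>
  let c : ℕ := i + 1
  1 / ((m : ℝ) * (m + 1) * ((harmonic m : ℝ) - 1)) *
    (if c ≤ m then (c : ℝ) else (m : ℝ) * (m + 1) / ((c : ℝ) - m + 2))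

/-- The random permutation model for an infinite sequence of random keys: for every `n` the
relative order of the first `n` keys is a uniformly random permutation. That is, for each
permutation `σ`, the keys numbered `σ 0, …, σ (n - 1)` are in increasing order with
probability `1 / n!`. -/
def IsRandomPermutationModel {Ω : Type*} [MeasurableSpace Ω] (P : Measure Ω)
    (U : ℕ → Ω → ℝ) : Prop :=
  (∀ k, Measurable (U k)) ∧
    ∀ (n : ℕ) (σ : Equiv.Perm (Fin n)),
      P {ω | StrictMono fun k : Fin n => U (σ k) ω} = ((n.factorial : ENNReal))⁻¹

/-- Independent keys with a common continuous (atomless) distribution follow the random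
permutation model. -/
theorem isRandomPermutationModel_of_iid {Ω : Type*} [MeasurableSpace Ω] (P : Measure Ω)
    [IsProbabilityMeasure P] (U : ℕ → Ω → ℝ) (hm : ∀ k, Measurable (U k)) (hi : iIndepFun U P)
    (ν : Measure ℝ) [NullSingletonClass ν] (hν : ∀ k, P.map (U k) = ν) : IsRandomPermutationModel P U := by
  refine ⟨hm, fun n => ?_⟩
  have : IsProbabilityMeasure ν := hν 0 ▸ Measure.isProbabilityMeasure_map (hm 0).aemeasurable
  let A : Equiv.Perm (Fin n) → Set Ω := fun σ => {ω | StrictMono fun k : Fin n => U (σ k) ω}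
  let E : Set (Fin n → ℝ) := {x | StrictMono x}
  have hE : MeasurableSet E := by
    have : E = ⋂ i, ⋂ j, ⋂ (_ : i < j), {x : Fin n → ℝ | x i < x j} := by
      ext x; simp [E, StrictMono]
    rw [this]
    refine MeasurableSet.iInter fun i => MeasurableSet.iInter fun j =>
      MeasurableSet.iInter fun _ => measurableSet_lt (measurable_pi_apply i) (measurable_pi_apply j)
  have hmeas : ∀ σ : Equiv.Perm (Fin n), Measurable fun ω => fun k : Fin n => U (σ k) ω :=
    fun σ => measurable_pi_lambda _ fun k => hm _
  have hA : ∀ σ, MeasurableSet (A σ) := fun σ => hmeas σ hE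
  have heq : ∀ σ, P (A σ) = Measure.pi (fun _ : Fin n => ν) E := by
    intro σ
    have h1 : iIndepFun (fun k : Fin n => U (σ k)) P :=
      hi.precomp (g := fun k : Fin n => ((σ k : Fin n) : ℕ))
        (Fin.val_injective.comp σ.injective)
    rw [iIndepFun_iff_map_fun_eq_pi_map (fun k => (hm _).aemeasurable)] at h1
    simp only [hν] at h1
    rw [← h1, Measure.map_apply (hmeas σ) hE]
    rfl
  have hdisj : Pairwise (Function.onFun Disjoint A) := by
    intro σ τ hne
    rw [Function.onFun, Set.disjoint_left]
    intro ω h1 h2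
    apply hne
    have hinj : Function.Injective fun k : Fin n => U k ω := by
      intro a b hab
      have : σ.symm a = σ.symm b := h1.injective (by simpa using hab)
      exact σ.symm.injective this
    have e1 := Tuple.unique_monotone (f := fun k : Fin n => U k ω) (σ := σ) (τ := τ)
      h1.monotone h2.monotone
    ext k
    exact congrArg Fin.val (hinj (congrFun e1 k))
  have hties : ∀ i j : ℕ, i ≠ j → ∀ᵐ ω ∂P, U i ω ≠ U j ω := by
    intro i j hij
    have h1 := hi.indepFun hij
    rw [indepFun_iff_map_prod_eq_prod_map_map (hm i).aemeasurable (hm j).aemeasurable] at h1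
    have h2 : P.map (fun ω => (U i ω, U j ω)) (Set.diagonal ℝ) = 0 := by
      rw [h1, hν, hν, Measure.prod_apply measurableSet_diagonal]
      simp [Set.preimage, Set.mem_diagonal_iff]
    rw [Measure.map_apply ((hm i).prodMk (hm j)) measurableSet_diagonal] at h2
    rw [ae_iff]
    simpa [Set.preimage] using h2
  have hcover : P (⋃ σ, A σ) = 1 := by
    rw [← measure_univ (μ := P)]
    apply measure_congr
    have : ∀ᵐ ω ∂P, ∀ i j : ℕ, i ≠ j → U i ω ≠ U j ω := by
      rw [ae_all_iff]; intro i; rw [ae_all_iff]; intro j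
      by_cases h : i = j
      · simp [h]
      · filter_upwards [hties i j h] with ω hω _ using hω
    rw [eventuallyEq_univ]
    filter_upwards [this] with ω hω
    refine Set.mem_iUnion.2 ⟨Tuple.sort fun k : Fin n => U k ω, ?_⟩
    refine (Tuple.monotone_sort fun k : Fin n => U k ω).strictMono_of_injective ?_
    intro a b hab
    by_contra hne
    exact hω _ _ (fun h => hne ((Tuple.sort _).injective (Fin.val_injective h))) hab
  rw [measure_iUnion hdisj hA, tsum_fintype] at hcover
  intro σ
  have h0 : (n.factorial : ENNReal) * P (A σ) = 1 := by
    rw [← hcover]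
    simp [heq, Fintype.card_perm]
  exact ENNReal.eq_inv_of_mul_eq_one_left (by rwa [mul_comm] at h0)

/-!
The gap numbers `X n` form a generalized Pólya urn: a new key reaches each of the `n + 1` gaps with
the same probability, and a gap of type `i` changes the gap vector by the row `i` of the replacement
matrix `A`. The rows of `A` have the sum `1`, its off-diagonal entries are nonnegative, and
`v = limitVector m` is a positive left eigenvector for the eigenvalue `1`
(`sum_limitVector_mul_replacementMatrix`). The argument rests on the weighted norm
`V y = ∑ j, y j ^ 2 / v j` and on the Dirichlet form
`D y = ∑ i j, v i * A i j * (y i / v i - y j / v j) ^ 2`, which satisfy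
`∑ i j, y i * A i j * y j / v j = V y - D y / 2` (`sum_mul_mul_div_eq`). Since consecutive colors
communicate, `D` controls the differences of the densities `y i / v i` at consecutive colors
(`exists_mul_sq_sub_le_dirichletForm`).

*Eigenvectors.* A left eigenvector `w` for the eigenvalue `1` has `D w = 0`, so its density with
respect to `v` is constant. The Gershgorin discs of the rows of `A` lie in the half-plane
`Re ≤ 1` and touch its boundary only at `1`, which bounds the other eigenvalues.

*The urn.* In a search tree with distinct keys, the gaps are the places immediately after a key and
the place before all keys; hence a sum over these places of a function of the gap type is a sum over
the gaps (`MaryTree.gapType_add_keySum_gapType`). A permutation of `n + 1` ranks consists of a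
permutation of `n` ranks and an arbitrary last rank, and so the mean over permutations
follows the urn (`MaryTree.sum_perm_gapVector_succ`).

*Almost sure convergence.* The increments of the gap vector are bounded, so the urn step gives
`E V(X (n + 1)) ≤ (1 + 2 / (n + 1)) E V(X n) - E D(X n) / (n + 1) + K`. After division
by `(n + 2) (n + 3)` the inequality telescopes, and `∑ E D(X n) / n ^ 3 < ∞`
(`MaryTree.summable_permMean_dirichletForm`). Therefore `∑ D(X n) / n ^ 3 < ∞` almost surely. With
`z n` the difference of the densities of `X n` at two consecutive colors, `∑ (z n / n) ^ 2 / n < ∞`;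
as the increments of `z` are bounded, this forces `z n / n → 0` (`tendsto_div_of_summable_sq`).
So all densities have the same asymptotic behavior, and the total number `n + 1` of gaps shows that
they are asymptotic to `n`.
-/

/-! ### Search trees and their gaps -/

namespace MaryTree

variable {m : ℕ} {α β : Type*}

/-- All keys of the tree satisfy `p`. -/
def AllKeys (p : α → Prop) : MaryTree m α → Prop
  | empty => True
  | node keys children => (∀ k ∈ keys, p k) ∧ ∀ j, AllKeys p (children j)

/-- The sum of `ψ` over the keys of a tree. -/
def keySum (ψ : α → ℝ) : MaryTree m α → ℝ
  | empty => 0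
  | node keys children => (keys.map ψ).sum + ∑ j, keySum ψ (children j)

/-- The tree with every key replaced by its image under `f`. -/
def mapKeys (f : α → β) : MaryTree m α → MaryTree m β
  | empty => empty
  | node keys children => node (keys.map f) fun j => mapKeys f (children j)

/-- The `m`-ary search trees with distinct keys: nodes are nonempty and sorted, only full nodes
have subtrees, and the keys in the subtree number `j` of a node are exactly those that the node
directs there. -/
def IsSearchTree [LinearOrder α] : MaryTree m α → Prop
  | empty => True
  | node keys children =>
    keys ≠ [] ∧ keys.length ≤ m - 1 ∧ keys.Pairwise (· < ·) ∧
      (keys.length < m - 1 → ∀ j, children j = empty) ∧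
      ∀ j : Fin m, IsSearchTree (children j) ∧
        AllKeys (fun k => k ∉ keys ∧ keys.countP (fun a => decide (a ≤ k)) = j) (children j)

/-- The number of empty entries in a family of trees. -/
def emptyCount (children : Fin m → MaryTree m α) : ℕ :=
  (Finset.univ.filter fun j => (children j).isEmpty = true).card

/-- The type of the gap that a new key reaches, where `p` tells which keys are at most the new
key. The value `g` is returned for an empty tree, which is a gap of its parent. -/
def gapType (g : ℕ) (p : α → Bool) : MaryTree m α → ℕ
  | empty => g
  | node keys children =>
    if keys.length < m - 1 then m + keys.length
    else if h : keys.countP p < m then gapType (emptyCount children) p (children ⟨_, h⟩)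
    else 0

/-- The number of gaps of type `i` in a subtree, where an empty subtree counts as a single gap
of type `g`. -/
def subtreeGapCount (g : ℕ) (t : MaryTree m α) (i : ℕ) : ℕ :=
  if t.isEmpty then (if i = g then 1 else 0) else gapCount t i

lemma AllKeys.mono {p q : α → Prop} {t : MaryTree m α} (hp : AllKeys p t)
    (h : ∀ k, p k → q k) : AllKeys q t := by
  induction t with
  | empty => trivial
  | node keys ch ih => exact ⟨fun k hk => h _ (hp.1 k hk), fun j => ih j (hp.2 j)⟩

lemma keySum_congr {ψ χ : α → ℝ} {t : MaryTree m α} (h : AllKeys (fun k => ψ k = χ k) t) :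
    keySum ψ t = keySum χ t := by
  induction t with
  | empty => rfl
  | node keys ch ih =>
    simp only [keySum]
    rw [List.map_congr_left h.1, Finset.sum_congr rfl fun j _ => ih j (h.2 j)]

lemma gapType_congr {p q : α → Bool} {t : MaryTree m α} (h : AllKeys (fun k => p k = q k) t)
    (g : ℕ) : gapType g p t = gapType g q t := by
  induction t generalizing g with
  | empty => rfl
  | node keys ch ih =>
    have hc : keys.countP p = keys.countP q :=
      List.countP_congr fun k hk => by rw [h.1 k hk]
    simp only [gapType, hc]
    split_ifs
    · rfl
    · exact ih _ (h.2 _) _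
    · rfl

lemma isEmpty_mapKeys (f : α → β) (t : MaryTree m α) : (mapKeys f t).isEmpty = t.isEmpty := by
  cases t <;> rfl

lemma gapType_mapKeys (f : α → β) (g : ℕ) (p : β → Bool) (t : MaryTree m α) :
    gapType g p (mapKeys f t) = gapType g (fun k => p (f k)) t := by
  induction t generalizing g with
  | empty => rfl
  | node keys ch ih =>
    have hc : emptyCount (fun j => mapKeys f (ch j)) = emptyCount ch := by
      simp only [emptyCount, isEmpty_mapKeys]
    have hp : keys.countP (p ∘ f) = keys.countP (fun k => p (f k)) := rfl
    simp only [mapKeys, gapType, List.length_map, List.countP_map, hc, hp, ih]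

lemma gapCount_mapKeys (f : α → β) (t : MaryTree m α) (i : ℕ) :
    gapCount (mapKeys f t) i = gapCount t i := by
  induction t with
  | empty => rfl
  | node keys ch ih =>
    simp only [mapKeys, gapCount, List.length_map, isEmpty_mapKeys, ih]

lemma isEmpty_insertKey [LinearOrder α] (x : α) (t : MaryTree m α) :
    (insertKey x t).isEmpty = false := by
  cases t with
  | empty => rfl
  | node keys ch => simp only [insertKey]; split_ifs <;> rfl

lemma insertKey_mapKeys [LinearOrder α] [LinearOrder β] {f : α → β} (hf : StrictMono f) (x : α)
    (t : MaryTree m α) : insertKey (f x) (mapKeys f t) = mapKeys f (insertKey x t) := by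
  induction t with
  | empty => rfl
  | node keys ch ih =>
    simp only [mapKeys, insertKey, List.length_map, List.countP_map]
    have hc : keys.countP ((fun k => decide (k ≤ f x)) ∘ f)
        = keys.countP (fun k => decide (k ≤ x)) :=
      List.countP_congr fun k _ => by simp [hf.le_iff_le]
    rw [hc]
    split_ifs
    · simp only [mapKeys]
      rw [List.map_orderedInsert (r := (· ≤ ·)) (s := (· ≤ ·))]
      · intro a _; exact hf.le_iff_le.symm
      · intro a _; exact hf.le_iff_le.symm
    · simp only [mapKeys]
      congr 1
      funext j
      split_ifs
      · exact ih j
      · rfl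

lemma grow_mapKeys [LinearOrder α] [LinearOrder β] {f : α → β} (hf : StrictMono f) {x : ℕ → α}
    {y : ℕ → β} {n : ℕ} (h : ∀ i < n, y i = f (x i)) :
    grow m y n = mapKeys f (grow m x n) := by
  induction n with
  | zero => rfl
  | succ n ih =>
    simp only [grow]
    rw [h n (by omega), ih fun i hi => h i (by omega), insertKey_mapKeys hf]

lemma insertKey_node_full [LinearOrder α] {x : α} {keys : List α} {ch : Fin m → MaryTree m α}
    (hfull : ¬ keys.length < m - 1) (h : keys.countP (fun k => decide (k ≤ x)) < m) :
    insertKey x (node keys ch) = node keys (Function.update ch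
      ⟨keys.countP (fun k => decide (k ≤ x)), h⟩ (insertKey x (ch ⟨_, h⟩))) := by
  simp only [insertKey, if_neg hfull]
  congr 1
  funext i
  by_cases hi : (i : ℕ) = keys.countP (fun k => decide (k ≤ x))
  · have : i = ⟨_, h⟩ := Fin.ext hi
    subst this
    simp
  · rw [if_neg hi, Function.update_of_ne]
    exact fun e => hi (by rw [e])

lemma sum_update_add {M ι T : Type*} [AddCommMonoid M] [Fintype ι] [DecidableEq ι] (F : T → M)
    (ch : ι → T) (c : ι) (t : T) :
    ∑ j, F (Function.update ch c t j) + F (ch c) = ∑ j, F (ch j) + F t := by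
  have h : ∑ j ∈ Finset.univ.erase c, F (Function.update ch c t j)
      = ∑ j ∈ Finset.univ.erase c, F (ch j) :=
    Finset.sum_congr rfl fun j hj => by
      rw [Function.update_of_ne (Finset.ne_of_mem_erase hj)]
  rw [← Finset.add_sum_erase _ _ (Finset.mem_univ c), h,
    ← Finset.add_sum_erase Finset.univ (fun j => F (ch j)) (Finset.mem_univ c)]
  simp only [Function.update_self]
  abel

lemma countP_lt_of_length_le {m : ℕ} (hm : 1 ≤ m) {keys : List α} (h : keys.length ≤ m - 1)
    (p : α → Bool) : keys.countP p < m :=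
  lt_of_le_of_lt List.countP_le_length (by omega)

lemma emptyCount_eq_sum (ch : Fin m → MaryTree m α) :
    emptyCount ch = ∑ j, (if (ch j).isEmpty = true then 1 else 0) := by
  rw [emptyCount, Finset.card_filter]

lemma emptyCount_le (ch : Fin m → MaryTree m α) : emptyCount ch ≤ m :=
  (Finset.card_filter_le _ _).trans (by simp)

lemma gapCount_node_full {keys : List α} {ch : Fin m → MaryTree m α}
    (hfull : ¬ keys.length < m - 1) (i : ℕ) :
    gapCount (node keys ch) i
      = (if i = emptyCount ch then i else 0) + ∑ j, gapCount (ch j) i := by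
  simp only [gapCount, if_neg hfull]
  rfl

lemma gapCount_node_full' {keys : List α} {ch : Fin m → MaryTree m α}
    (hfull : ¬ keys.length < m - 1) (i : ℕ) :
    gapCount (node keys ch) i = ∑ j, subtreeGapCount (emptyCount ch) (ch j) i := by
  rw [gapCount_node_full hfull]
  have : ∀ j, subtreeGapCount (emptyCount ch) (ch j) i =
      (if i = emptyCount ch then (if (ch j).isEmpty = true then 1 else 0) else 0)
        + gapCount (ch j) i := by
    intro j
    unfold subtreeGapCount
    cases h : ch j <;> simp [isEmpty, gapCount]
  simp only [this, Finset.sum_add_distrib]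
  congr 1
  split_ifs with h
  · rw [← emptyCount_eq_sum, h]
  · simp

/-- Insertion of a key changes the numbers of gaps by the row of the replacement matrix that
belongs to the type of the gap reached. -/
lemma gapCount_insertKey [LinearOrder α] (hm : 2 ≤ m) (x : α) {t : MaryTree m α}
    (ht : IsSearchTree t) (hne : t.isEmpty = false) (g i : ℕ) :
    (gapCount (insertKey x t) i : ℤ)
      = gapCount t i + replacementEntry m (gapType g (fun k => decide (k ≤ x)) t) i := by
  induction t generalizing g with
  | empty => simp [isEmpty] at hne
  | node keys ch ih =>
    obtain ⟨h0, hlen, -, hleaf, hch⟩ := ht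
    have hpos : 0 < keys.length := List.length_pos_iff.2 h0
    by_cases hfull : keys.length < m - 1
    · -- a leaf that still has room
      have hemp := hleaf hfull
      have e1 : emptyCount ch = m := by simp [emptyCount, hemp, isEmpty]
      have e2 : ∀ j, gapCount (ch j) i = 0 := fun j => by rw [hemp]; rfl
      rw [insertKey, if_pos hfull, gapType, if_pos hfull]
      by_cases hf' : keys.length + 1 < m - 1
      · simp only [gapCount, List.orderedInsert_length, if_pos hf', if_pos hfull,
          replacementEntry, leafColor]
        grind
      · rw [gapCount_node_full (by rwa [List.orderedInsert_length]), e1]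
        simp only [gapCount, if_pos hfull, e2, Finset.sum_const_zero,
          replacementEntry, leafColor]
        grind
    · have hc := countP_lt_of_length_le (by omega) hlen (fun k => decide (k ≤ x))
      rw [insertKey_node_full hfull hc, gapCount_node_full hfull, gapCount_node_full hfull,
        gapType, if_neg hfull, dif_pos hc]
      set c : Fin m := ⟨keys.countP (fun k => decide (k ≤ x)), hc⟩
      have s1 := sum_update_add (fun t => gapCount t i) ch c (insertKey x (ch c))
      have s2 := sum_update_add (fun t : MaryTree m α => if t.isEmpty = true then 1 else 0) ch c
        (insertKey x (ch c))
      simp only [← emptyCount_eq_sum, isEmpty_insertKey] at s2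
      cases hE : (ch c).isEmpty
      · have h2 : emptyCount (Function.update ch c (insertKey x (ch c))) = emptyCount ch := by
          simpa [hE] using s2
        have h3 := ih c (hch c).1 hE (emptyCount ch)
        rw [h2]
        push_cast
        have s1' : (∑ j, (gapCount (Function.update ch c (insertKey x (ch c)) j) i : ℤ))
            + gapCount (ch c) i = ∑ j, (gapCount (ch j) i : ℤ)
              + gapCount (insertKey x (ch c)) i := by exact_mod_cast s1
        linarith
      · -- the key opens a new leaf
        have hcc : ch c = empty := by
          cases h : ch c with
          | empty => rfl
          | node => rw [h] at hE; simp [isEmpty] at hE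
        have h2 : emptyCount (Function.update ch c (insertKey x (ch c))) + 1 = emptyCount ch := by
          simpa [hE] using s2
        have hle := emptyCount_le ch
        have h3 : gapCount (insertKey x (ch c)) i = if i = leafColor m 1 then 2 else 0 := by
          rw [hcc, insertKey]
          by_cases hm2 : 1 < m - 1
          · simp only [gapCount, List.length_singleton, if_pos hm2, leafColor]
            grind
          · rw [gapCount_node_full (by simpa using hm2)]
            have : emptyCount (fun _ : Fin m => (empty : MaryTree m α)) = m := by
              simp [emptyCount, isEmpty]
            simp only [this, gapCount, Finset.sum_const_zero, leafColor]
            grind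
        have h4 : gapCount (ch c) i = 0 := by rw [hcc]; rfl
        have h5 : gapType (emptyCount ch) (fun k => decide (k ≤ x)) (ch c) = emptyCount ch := by
          rw [hcc]; rfl
        rw [h5]
        simp only [h4, add_zero] at s1
        rw [s1, h3]
        rw [replacementEntry, if_pos hle]
        push_cast
        grind

lemma AllKeys.insertKey [LinearOrder α] {p : α → Prop} {x : α} {t : MaryTree m α}
    (ht : AllKeys p t) (hx : p x) : AllKeys p (insertKey x t) := by
  induction t with
  | empty => exact ⟨by simpa using hx, fun _ => trivial⟩
  | node keys ch ih =>
    simp only [MaryTree.insertKey]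
    split_ifs
    · refine ⟨fun k hk => ?_, ht.2⟩
      rcases (List.mem_orderedInsert _).1 hk with rfl | hk
      · exact hx
      · exact ht.1 k hk
    · refine ⟨ht.1, fun j => ?_⟩
      dsimp only
      split_ifs
      · exact ih j (ht.2 j)
      · exact ht.2 j

lemma IsSearchTree.insertKey [LinearOrder α] (hm : 2 ≤ m) {x : α} {t : MaryTree m α}
    (ht : IsSearchTree t) (hx : AllKeys (fun k => k ≠ x) t) : IsSearchTree (insertKey x t) := by
  induction t with
  | empty =>
    refine ⟨by simp, by simp; omega, by simp, fun _ _ => rfl, fun _ => ⟨trivial, trivial⟩⟩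
  | node keys ch ih =>
    obtain ⟨h0, hlen, hs, hleaf, hch⟩ := ht
    by_cases hfull : keys.length < m - 1
    · rw [MaryTree.insertKey, if_pos hfull]
      refine ⟨?_, ?_, ?_, fun _ => hleaf hfull, fun j => ?_⟩
      · exact List.ne_nil_of_length_pos (by rw [List.orderedInsert_length]; omega)
      · rw [List.orderedInsert_length]; omega
      · have h1 : (keys.orderedInsert (· ≤ ·) x).Pairwise (· ≤ ·) :=
          List.Pairwise.orderedInsert x keys (hs.imp le_of_lt)
        have h2 : (keys.orderedInsert (· ≤ ·) x).Nodup := by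
          rw [(List.perm_orderedInsert _ x keys).nodup_iff, List.nodup_cons]
          exact ⟨fun h => hx.1 x h rfl, hs.imp ne_of_lt⟩
        exact h1.imp₂ (fun _ _ h h' => lt_of_le_of_ne h h') h2
      · rw [hleaf hfull]; exact ⟨trivial, trivial⟩
    · have hc := countP_lt_of_length_le (by omega) hlen (fun k => decide (k ≤ x))
      rw [insertKey_node_full hfull hc]
      refine ⟨h0, hlen, hs, fun h => absurd h hfull, fun j => ?_⟩
      by_cases hj : j = ⟨_, hc⟩
      · subst hj
        simp only [Function.update_self]
        exact ⟨ih _ (hch _).1 (hx.2 _),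
          AllKeys.insertKey (hch ⟨_, hc⟩).2 ⟨fun h => hx.1 x h rfl, rfl⟩⟩
      · rw [Function.update_of_ne hj]
        exact hch j

lemma keySum_insertKey [LinearOrder α] (hm : 2 ≤ m) (ψ : α → ℝ) (x : α) {t : MaryTree m α}
    (ht : IsSearchTree t) : keySum ψ (insertKey x t) = ψ x + keySum ψ t := by
  induction t with
  | empty => simp [insertKey, keySum]
  | node keys ch ih =>
    obtain ⟨h0, hlen, hs, hleaf, hch⟩ := ht
    by_cases hfull : keys.length < m - 1
    · rw [insertKey, if_pos hfull]
      simp only [keySum]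
      rw [((List.perm_orderedInsert _ x keys).map ψ).sum_eq]
      simp [add_assoc]
    · have hc := countP_lt_of_length_le (by omega) hlen (fun k => decide (k ≤ x))
      rw [insertKey_node_full hfull hc]
      simp only [keySum]
      have s1 := sum_update_add (fun t => keySum ψ t) ch ⟨_, hc⟩ (insertKey x (ch ⟨_, hc⟩))
      have := ih ⟨_, hc⟩ (hch _).1
      linarith

lemma countP_le_getElem [LinearOrder α] {keys : List α} (hs : keys.Pairwise (· < ·)) {i : ℕ}
    (hi : i < keys.length) : keys.countP (fun a => decide (a ≤ keys[i])) = i + 1 := by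
  have hsm := List.pairwise_iff_getElem.1 hs
  generalize hb : keys[i] = b
  rw [← List.take_append_drop (i + 1) keys, List.countP_append, List.countP_eq_length.2,
    List.countP_eq_zero.2]
  · simp; omega
  · intro a ha
    obtain ⟨k, hk, rfl⟩ := List.mem_iff_getElem.1 ha
    simp only [List.length_drop] at hk
    simp only [List.getElem_drop, decide_eq_true_eq, not_le, ← hb]
    exact hsm _ _ _ _ (by omega)
  · intro a ha
    obtain ⟨k, hk, rfl⟩ := List.mem_iff_getElem.1 ha
    simp only [List.length_take] at hk
    simp only [List.getElem_take, decide_eq_true_eq, ← hb]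
    rcases eq_or_lt_of_le (show k ≤ i by omega) with h | h
    · subst h; exact le_rfl
    · exact (hsm _ _ _ _ h).le

lemma countP_le_lt_countP_le [LinearOrder α] {keys : List α} {k b : α} (hkb : k < b)
    (hb : b ∈ keys) :
    keys.countP (fun a => decide (a ≤ k)) < keys.countP (fun a => decide (a ≤ b)) := by
  have hsplit : ∀ l : List α, l.countP (fun a => decide (a ≤ b)) =
      l.countP (fun a => decide (a ≤ k)) + l.countP (fun a => decide (k < a ∧ a ≤ b)) := by
    intro l
    induction l with
    | nil => rfl
    | cons a l ih => simp only [List.countP_cons, ih]; grind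
  have : 0 < keys.countP (fun a => decide (k < a ∧ a ≤ b)) :=
    List.countP_pos_iff.2 ⟨b, hb, by simpa using hkb⟩
  rw [hsplit]
  omega

/-- In a search tree, the gaps are the positions immediately after the keys, together with the
position before all keys: a function of the type of the gap can be summed either way. -/
lemma gapType_add_keySum_gapType [LinearOrder α] (hm : 2 ≤ m) (φ : ℕ → ℝ) {t : MaryTree m α}
    (ht : IsSearchTree t) (g : ℕ) (hg : t.isEmpty = true → g < 2 * m - 1) :
    φ (gapType g (fun _ => false) t) + keySum (fun k => φ (gapType g (fun a => decide (a ≤ k)) t)) t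
      = ∑ c ∈ Finset.range (2 * m - 1), (subtreeGapCount g t c : ℝ) * φ c := by
  induction t generalizing g with
  | empty =>
    have := hg rfl
    simp only [gapType, keySum, subtreeGapCount, isEmpty]
    simp [this]
  | node keys ch ih =>
    obtain ⟨h0, hlen, hs, hleaf, hch⟩ := ht
    have hpos : 0 < keys.length := List.length_pos_iff.2 h0
    have hsub : ∀ c, subtreeGapCount g (node keys ch) c = gapCount (node keys ch) c := by
      intro c; simp [subtreeGapCount, isEmpty]
    simp only [hsub]
    by_cases hfull : keys.length < m - 1
    · have hemp := hleaf hfull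
      simp only [gapType, if_pos hfull, keySum, gapCount, hemp, Finset.sum_const_zero]
      simp only [List.map_const', List.sum_replicate, nsmul_eq_mul, add_zero, Nat.cast_ite,
        Nat.cast_zero, ite_mul, zero_mul]
      rw [Finset.sum_ite_eq', if_pos (by rw [Finset.mem_range]; omega)]
      push_cast
      ring
    · obtain ⟨n, rfl⟩ : ∃ n, m = n + 1 := ⟨m - 1, by omega⟩
      have hlen' : keys.length = n := by omega
      set G := emptyCount ch with hG
      -- the gap reached from the root is the gap reached in the subtree to which one is directed
      have hroot : ∀ (p : α → Bool) (j : Fin (n + 1)), keys.countP p = j →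
          gapType g p (node keys ch) = gapType G p (ch j) := by
        intro p j hj
        rw [gapType, if_neg hfull, dif_pos (by omega)]
        congr 2
        exact Fin.ext hj
      have hcount : ∀ i : Fin n, keys.countP (fun a => decide (a ≤ keys[i])) = i + 1 := by
        intro i
        have hi : (i : ℕ) < keys.length := by omega
        exact countP_le_getElem hs hi
      have hfirst : gapType g (fun _ => false) (node keys ch)
          = gapType G (fun _ => false) (ch 0) := hroot _ 0 (by simp)
      have hkey : ∀ i : Fin n, gapType g (fun a => decide (a ≤ keys[i])) (node keys ch)
          = gapType G (fun _ => false) (ch i.succ) := by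
        intro i
        rw [hroot _ i.succ (by rw [hcount]; simp)]
        refine gapType_congr ((hch i.succ).2.mono fun k hk => ?_) _
        rw [decide_eq_false_iff_not]
        intro hle
        have hlt : k < keys[i] := lt_of_le_of_ne hle fun h => hk.1 (h ▸ List.getElem_mem _)
        have hle' := countP_le_lt_countP_le hlt (List.getElem_mem (l := keys) (n := i) (by omega))
        rw [hk.2, hcount] at hle'
        simp at hle'
      have hchild : ∀ j, keySum (fun k => φ (gapType g (fun a => decide (a ≤ k)) (node keys ch)))
          (ch j) = keySum (fun k => φ (gapType G (fun a => decide (a ≤ k)) (ch j))) (ch j) :=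
        fun j => keySum_congr ((hch j).2.mono fun k hk => by rw [hroot _ j hk.2])
      have hmap : (keys.map fun k => φ (gapType g (fun a => decide (a ≤ k)) (node keys ch))).sum
          = ∑ i : Fin n, φ (gapType G (fun _ => false) (ch i.succ)) := by
        simp only [← hkey]
        rw [← List.sum_ofFn]
        congr 1
        apply List.ext_getElem
        · simp [hlen']
        · intro k h1 h2
          simp
      have hGlt : ∀ j, (ch j).isEmpty = true → G < 2 * (n + 1) - 1 := fun _ _ => by
        have := emptyCount_le ch
        omega
      rw [keySum, hmap, hfirst, ← add_assoc,
        ← Fin.sum_univ_succ fun j => φ (gapType G (fun _ => false) (ch j)),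
        Finset.sum_congr rfl fun j _ => hchild j, ← Finset.sum_add_distrib,
        Finset.sum_congr rfl fun j _ => ih j (hch j).1 G (hGlt j), Finset.sum_comm]
      refine Finset.sum_congr rfl fun c _ => ?_
      rw [gapCount_node_full' hfull, Nat.cast_sum, Finset.sum_mul]

end MaryTree

/-! ### Growing search trees -/

namespace MaryTree

variable {m : ℕ} {α β : Type*}

lemma allKeys_grow [LinearOrder α] {p : α → Prop} {x : ℕ → α} {n : ℕ} (h : ∀ i < n, p (x i)) :
    AllKeys p (grow m x n) := by
  induction n with
  | zero => trivial
  | succ n ih => exact (ih fun i hi => h i (by omega)).insertKey (h n (by omega))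

lemma isSearchTree_grow [LinearOrder α] (hm : 2 ≤ m) {x : ℕ → α} {n : ℕ}
    (hx : Set.InjOn x (Set.Iio n)) : IsSearchTree (grow m x n) := by
  induction n with
  | zero => trivial
  | succ n ih =>
    refine (ih (hx.mono (Set.Iio_subset_Iio (by omega)))).insertKey hm (allKeys_grow ?_)
    intro i hi h
    exact hi.ne (hx (by simp; omega) (by simp) h)

lemma isEmpty_grow_succ [LinearOrder α] (x : ℕ → α) (n : ℕ) :
    (grow m x (n + 1)).isEmpty = false := isEmpty_insertKey _ _

lemma keySum_grow [LinearOrder α] (hm : 2 ≤ m) (ψ : α → ℝ) {x : ℕ → α} {n : ℕ}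
    (hx : Set.InjOn x (Set.Iio n)) : keySum ψ (grow m x n) = ∑ i ∈ Finset.range n, ψ (x i) := by
  induction n with
  | zero => rfl
  | succ n ih =>
    have hx' := hx.mono (Set.Iio_subset_Iio (show n ≤ n + 1 by omega))
    rw [grow, keySum_insertKey hm ψ _ (isSearchTree_grow hm hx'), ih hx', Finset.sum_range_succ,
      add_comm]

lemma gapCount_zero (t : MaryTree m α) (hm : 2 ≤ m) : gapCount t 0 = 0 := by
  induction t with
  | empty => rfl
  | node keys ch ih =>
    simp only [gapCount, ih]
    grind [Finset.sum_const_zero]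

/-- The numbers of gaps of the types `1, …, 2m - 2` after the insertion of `n` keys. -/
def gapVector [LinearOrder α] (m : ℕ) (x : ℕ → α) (n : ℕ) : Fin (2 * m - 2) → ℝ :=
  fun i => gapCount (grow m x n) (i + 1)

lemma gapVector_nonneg [LinearOrder α] (x : ℕ → α) (n : ℕ) (i : Fin (2 * m - 2)) :
    0 ≤ gapVector m x n i := Nat.cast_nonneg _

lemma sum_range_gapCount_mul (hm : 2 ≤ m) (t : MaryTree m α) (φ : ℕ → ℝ) :
    ∑ c ∈ Finset.range (2 * m - 1), (gapCount t c : ℝ) * φ c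
      = ∑ i : Fin (2 * m - 2), (gapCount t (i + 1) : ℝ) * φ (i + 1) := by
  rw [show 2 * m - 1 = 2 * m - 2 + 1 by omega, Finset.sum_range_succ', gapCount_zero t hm]
  simp [Finset.sum_range]

lemma gapType_add_keySum_gapType_grow [LinearOrder α] (hm : 2 ≤ m) (φ : ℕ → ℝ) {x : ℕ → α}
    {n : ℕ} (hx : Set.InjOn x (Set.Iio (n + 1))) :
    φ (gapType 0 (fun _ => false) (grow m x (n + 1)))
        + ∑ i ∈ Finset.range (n + 1),
            φ (gapType 0 (fun a => decide (a ≤ x i)) (grow m x (n + 1)))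
      = ∑ i, gapVector m x (n + 1) i * φ (i + 1) := by
  have h := gapType_add_keySum_gapType hm φ (isSearchTree_grow hm hx) 0
    (by simp [isEmpty_grow_succ])
  rw [keySum_grow hm _ hx] at h
  rw [h]
  simp only [subtreeGapCount, isEmpty_grow_succ, Bool.false_eq_true, if_false]
  exact sum_range_gapCount_mul hm _ _

/-- A tree with `n + 1` keys has `n + 2` gaps. -/
lemma sum_gapVector [LinearOrder α] (hm : 2 ≤ m) {x : ℕ → α} {n : ℕ}
    (hx : Set.InjOn x (Set.Iio (n + 1))) : ∑ i, gapVector m x (n + 1) i = n + 2 := by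
  have h := gapType_add_keySum_gapType_grow hm (fun _ => 1) hx
  simp only [mul_one, Finset.sum_const, Finset.card_range, nsmul_eq_mul] at h
  rw [← h]
  push_cast
  ring

lemma gapVector_succ [LinearOrder α] (hm : 2 ≤ m) {x : ℕ → α} {n : ℕ}
    (hx : Set.InjOn x (Set.Iio (n + 1))) (i : Fin (2 * m - 2)) :
    gapVector m x (n + 2) i = gapVector m x (n + 1) i
      + replacementEntry m (gapType 0 (fun k => decide (k ≤ x (n + 1))) (grow m x (n + 1)))
          (i + 1) := by
  have h := gapCount_insertKey hm (x (n + 1)) (isSearchTree_grow hm hx) (isEmpty_grow_succ x n) 0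
    (i + 1)
  have h' : ((gapCount (insertKey (x (n + 1)) (grow m x (n + 1))) (i + 1) : ℤ) : ℝ)
    = ((_ : ℤ) : ℝ) := congrArg _ h
  push_cast at h'
  exact h'

lemma gapVector_eq_of_strictMono [LinearOrder α] [LinearOrder β] {f : α → β} (hf : StrictMono f)
    {x : ℕ → α} {y : ℕ → β} {n : ℕ} (h : ∀ i < n, y i = f (x i)) :
    gapVector m y n = gapVector m x n := by
  funext i
  simp only [gapVector, grow_mapKeys hf h, gapCount_mapKeys]

/-! ### Averages over permutations -/

/-- The sequence of keys that is given by a permutation of `0, …, n`; only its first `n + 1`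
members matter. -/
def permSeq {n : ℕ} (π : Equiv.Perm (Fin (n + 1))) (i : ℕ) : Fin (n + 1) := π (Fin.ofNat (n + 1) i)

lemma permSeq_of_lt {n : ℕ} (π : Equiv.Perm (Fin (n + 1))) {i : ℕ} (hi : i < n + 1) :
    permSeq π i = π ⟨i, hi⟩ := by
  simp [permSeq, Fin.ofNat, Nat.mod_eq_of_lt hi]

lemma injOn_permSeq {n : ℕ} (π : Equiv.Perm (Fin (n + 1))) :
    Set.InjOn (permSeq π) (Set.Iio (n + 1)) := by
  intro i hi j hj h
  rw [permSeq_of_lt π hi, permSeq_of_lt π hj] at h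
  exact congrArg Fin.val (π.injective h)

lemma injective_snoc_succAbove {n : ℕ} (r : Fin (n + 1)) (ρ : Equiv.Perm (Fin n)) :
    Function.Injective
      (Fin.snoc (α := fun _ => Fin (n + 1)) (fun i => r.succAbove (ρ i)) r) := by
  intro i j
  induction i using Fin.lastCases <;> induction j using Fin.lastCases <;>
    simp [Fin.succAbove_ne, Fin.ne_succAbove]

/-- The permutation whose last value is `r` and whose other values are ordered as in `ρ`. -/
noncomputable def snocPerm {n : ℕ} (r : Fin (n + 1)) (ρ : Equiv.Perm (Fin n)) :
    Equiv.Perm (Fin (n + 1)) :=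
  Equiv.ofBijective _ (Finite.injective_iff_bijective.1 (injective_snoc_succAbove r ρ))

lemma snocPerm_castSucc {n : ℕ} (r : Fin (n + 1)) (ρ : Equiv.Perm (Fin n)) (i : Fin n) :
    snocPerm r ρ i.castSucc = r.succAbove (ρ i) := by simp [snocPerm]

lemma snocPerm_last {n : ℕ} (r : Fin (n + 1)) (ρ : Equiv.Perm (Fin n)) :
    snocPerm r ρ (Fin.last n) = r := by simp [snocPerm]

lemma bijective_snocPerm (n : ℕ) :
    Function.Bijective fun p : Fin (n + 1) × Equiv.Perm (Fin n) => snocPerm p.1 p.2 := by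
  rw [Fintype.bijective_iff_injective_and_card]
  refine ⟨?_, ?_⟩
  · rintro ⟨r, ρ⟩ ⟨s, τ⟩ h
    dsimp only at h
    have hr : r = s := by rw [← snocPerm_last r ρ, h, snocPerm_last]
    subst hr
    congr 1
    ext i
    have := congrArg (fun π => π i.castSucc) h
    simp only [snocPerm_castSucc, Fin.succAbove_right_inj] at this
    rw [this]
  · simp [Fintype.card_perm, Nat.factorial_succ]

lemma sum_perm_succ {n : ℕ} (F : Equiv.Perm (Fin (n + 1)) → ℝ) :
    ∑ π, F π = ∑ ρ : Equiv.Perm (Fin n), ∑ r, F (snocPerm r ρ) := by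
  rw [← (bijective_snocPerm n).sum_comp, Fintype.sum_prod_type_right]

/-- One step of the urn: for uniformly random permutations, a gap of the tree is chosen uniformly
at random. -/
lemma sum_perm_gapVector_succ (hm : 2 ≤ m) (n : ℕ) (F : (Fin (2 * m - 2) → ℝ) → ℝ) :
    ∑ π : Equiv.Perm (Fin (n + 2)), F (gapVector m (permSeq π) (n + 2))
      = ∑ ρ : Equiv.Perm (Fin (n + 1)), ∑ i, gapVector m (permSeq ρ) (n + 1) i
          * F (gapVector m (permSeq ρ) (n + 1) + replacementMatrix m i) := by
  rw [sum_perm_succ]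
  refine Finset.sum_congr rfl fun ρ _ => ?_
  set t := grow m (permSeq ρ) (n + 1) with ht
  let φ : ℕ → ℝ := fun c =>
    F (gapVector m (permSeq ρ) (n + 1)
      + fun j : Fin (2 * m - 2) => (replacementEntry m c (j + 1) : ℝ))
  have hstep : ∀ r : Fin (n + 2), F (gapVector m (permSeq (snocPerm r ρ)) (n + 2))
      = φ (gapType 0 (fun k => decide (k.castSucc < r)) t) := by
    intro r
    have hmap : ∀ i < n + 1, permSeq (snocPerm r ρ) i = r.succAbove (permSeq ρ i) := by
      intro i hi
      rw [permSeq_of_lt _ (by omega), permSeq_of_lt _ hi, ← snocPerm_castSucc]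
      rfl
    have hlast : permSeq (snocPerm r ρ) (n + 1) = r := by
      rw [permSeq_of_lt _ (by omega)]
      exact snocPerm_last r ρ
    have hinj := (injOn_permSeq (snocPerm r ρ)).mono
      (Set.Iio_subset_Iio (show n + 1 ≤ n + 2 by omega))
    have hmono : StrictMono r.succAbove := Fin.strictMono_succAbove r
    congr 1
    funext i
    rw [gapVector_succ hm hinj, gapVector_eq_of_strictMono hmono hmap, grow_mapKeys hmono hmap,
      gapType_mapKeys, hlast]
    have hp : (fun k : Fin (n + 1) => decide (r.succAbove k ≤ r))
        = fun k => decide (k.castSucc < r) := by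
      funext k
      rw [decide_eq_decide, ← Fin.succAbove_lt_iff_castSucc_lt, lt_iff_le_and_ne]
      exact ⟨fun h => ⟨h, Fin.succAbove_ne r k⟩, fun h => h.1⟩
    rw [hp]
    rfl
  rw [Finset.sum_congr rfl fun r _ => hstep r, Fin.sum_univ_succ]
  have h := gapType_add_keySum_gapType_grow hm φ (injOn_permSeq ρ)
  have hsum : ∑ i ∈ Finset.range (n + 1),
        φ (gapType 0 (fun a => decide (a ≤ permSeq ρ i)) (grow m (permSeq ρ) (n + 1)))
      = ∑ k : Fin (n + 1), φ (gapType 0 (fun a => decide (a ≤ k)) t) := by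
    rw [Finset.sum_range, ← Equiv.sum_comp ρ fun k => φ (gapType 0 (fun a => decide (a ≤ k)) t)]
    refine Finset.sum_congr rfl fun i _ => ?_
    rw [permSeq_of_lt ρ i.2]
  rw [hsum] at h
  simp only [Fin.castSucc_lt_succ_iff, Fin.not_lt_zero, decide_false]
  exact h

end MaryTree

/-! ### The Dirichlet form of a replacement matrix -/

section DirichletForm

variable {ι : Type*} [Fintype ι]

/-- The square of the norm that is associated with the weights `1 / v i`. -/
noncomputable def weightedSq (v y : ι → ℝ) : ℝ := ∑ j, y j ^ 2 / v j

/-- The Dirichlet form, or energy, of the matrix `A` with respect to the weights `v`, at the density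
`y / v`. -/
noncomputable def dirichletForm (A : Matrix ι ι ℝ) (v y : ι → ℝ) : ℝ :=
  ∑ i, ∑ j, v i * A i j * (y i / v i - y j / v j) ^ 2

/-- The drift of the weighted norm along `A`. The Dirichlet form measures how far `y` is from
being a multiple of the left eigenvector `v`. -/
lemma sum_mul_mul_div_eq (A : Matrix ι ι ℝ) {v : ι → ℝ} (hv : ∀ i, 0 < v i)
    (hrow : ∀ i, ∑ j, A i j = 1) (hcol : ∀ j, ∑ i, v i * A i j = v j) (y : ι → ℝ) :
    ∑ i, ∑ j, y i * A i j * y j / v j = weightedSq v y - dirichletForm A v y / 2 := by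
  have e : ∀ i j, v i * A i j * (y i / v i - y j / v j) ^ 2
      = y i ^ 2 / v i * A i j + (v i * A i j) * (y j / v j) ^ 2
        - 2 * (y i * A i j * y j / v j) := by
    intro i j
    have := (hv i).ne'
    have := (hv j).ne'
    field_simp
    ring
  have h1 : ∑ i, ∑ j, y i ^ 2 / v i * A i j = weightedSq v y := by
    simp only [← Finset.mul_sum, hrow, mul_one]
    rfl
  have h2 : ∑ i, ∑ j, (v i * A i j) * (y j / v j) ^ 2 = weightedSq v y := by
    rw [Finset.sum_comm]
    simp only [← Finset.sum_mul, hcol]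
    refine Finset.sum_congr rfl fun j _ => ?_
    have := (hv j).ne'
    field_simp
  unfold dirichletForm
  simp only [e, Finset.sum_sub_distrib, Finset.sum_add_distrib]
  rw [h1, h2]
  simp only [← Finset.mul_sum]
  ring

/-- One step of the urn with replacement matrix `A` changes the weighted norm by this amount on
average. -/
lemma sum_mul_weightedSq_add (A : Matrix ι ι ℝ) {v : ι → ℝ} (hv : ∀ i, 0 < v i)
    (hrow : ∀ i, ∑ j, A i j = 1) (hcol : ∀ j, ∑ i, v i * A i j = v j) (y : ι → ℝ) :
    ∑ i, y i * weightedSq v (y + A i)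
      = (∑ i, y i + 2) * weightedSq v y - dirichletForm A v y
        + ∑ i, y i * weightedSq v (A i) := by
  have e : ∀ i, y i * weightedSq v (y + A i) = y i * weightedSq v y
      + 2 * (∑ j, y i * A i j * y j / v j) + y i * weightedSq v (A i) := by
    intro i
    simp only [weightedSq, Finset.mul_sum, ← Finset.sum_add_distrib]
    refine Finset.sum_congr rfl fun j _ => ?_
    simp only [Pi.add_apply]
    ring
  simp only [e, Finset.sum_add_distrib, ← Finset.mul_sum, ← Finset.sum_mul,
    sum_mul_mul_div_eq A hv hrow hcol]
  ring

lemma weightedSq_nonneg {v : ι → ℝ} (hv : ∀ i, 0 < v i) (y : ι → ℝ) : 0 ≤ weightedSq v y :=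
  Finset.sum_nonneg fun j _ => div_nonneg (sq_nonneg _) (hv j).le

lemma mul_sq_le_dirichletForm {A : Matrix ι ι ℝ} {v : ι → ℝ} (hv : ∀ i, 0 < v i)
    (hA : ∀ i j, i ≠ j → 0 ≤ A i j) (y : ι → ℝ) (a b : ι) :
    v a * A a b * (y a / v a - y b / v b) ^ 2 ≤ dirichletForm A v y := by
  have h0 : ∀ i j, 0 ≤ v i * A i j * (y i / v i - y j / v j) ^ 2 := by
    intro i j
    by_cases h : i = j
    · subst h; simp
    · exact mul_nonneg (mul_nonneg (hv i).le (hA i j h)) (sq_nonneg _)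
  exact (Finset.single_le_sum (fun j _ => h0 a j) (Finset.mem_univ b)).trans
    (Finset.single_le_sum (f := fun i => ∑ j, v i * A i j * (y i / v i - y j / v j) ^ 2)
      (fun i _ => Finset.sum_nonneg fun j _ => h0 i j) (Finset.mem_univ a))

lemma dirichletForm_nonneg {A : Matrix ι ι ℝ} {v : ι → ℝ} (hv : ∀ i, 0 < v i)
    (hA : ∀ i j, i ≠ j → 0 ≤ A i j) (y : ι → ℝ) : 0 ≤ dirichletForm A v y := by
  refine Finset.sum_nonneg fun i _ => Finset.sum_nonneg fun j _ => ?_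
  by_cases h : i = j
  · subst h; simp
  · exact mul_nonneg (mul_nonneg (hv i).le (hA i j h)) (sq_nonneg _)

/-- The Gershgorin discs of the rows touch the line `Re = 1` only at `1`. -/
lemma re_lt_one_of_hasEigenvalue_transpose [DecidableEq ι] {A : Matrix ι ι ℝ}
    (hA : ∀ i j, i ≠ j → 0 ≤ A i j) (hrow : ∀ i, ∑ j, A i j = 1) {μ : ℂ}
    (hμ : Module.End.HasEigenvalue
      (Matrix.toLin' (A.transpose.map fun a : ℝ => (a : ℂ))) μ) (h1 : μ ≠ 1) : μ.re < 1 := by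
  by_contra! hre
  obtain ⟨x, hx⟩ := hμ.exists_hasEigenvector
  set M := A.transpose.map fun a : ℝ => (a : ℂ)
  have hdet : (M - μ • (1 : Matrix ι ι ℂ)).det = 0 := by
    refine Matrix.exists_mulVec_eq_zero_iff.1 ⟨x, hx.2, ?_⟩
    have := hx.apply_eq_smul
    rw [Matrix.toLin'_apply] at this
    rw [Matrix.sub_mulVec, this, Matrix.smul_mulVec, Matrix.one_mulVec, sub_self]
  refine det_ne_zero_of_sum_col_lt_diag (fun k => ?_) hdet
  have hsum : ∑ i ∈ Finset.univ.erase k, ‖(M - μ • (1 : Matrix ι ι ℂ)) i k‖ = 1 - A k k := by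
    rw [← hrow k, ← Finset.add_sum_erase _ _ (Finset.mem_univ k), add_sub_cancel_left]
    refine Finset.sum_congr rfl fun i hi => ?_
    have hik := Finset.ne_of_mem_erase hi
    simp [M, hik, abs_of_nonneg (hA k i hik.symm)]
  have hkk : A k k ≤ 1 := by
    rw [← hrow k, ← Finset.add_sum_erase _ _ (Finset.mem_univ k)]
    have := Finset.sum_nonneg (s := Finset.univ.erase k) (f := fun j => A k j)
      fun j hj => hA k j (Finset.ne_of_mem_erase hj).symm
    linarith
  have hdiag : (M - μ • (1 : Matrix ι ι ℂ)) k k = (A k k : ℂ) - μ := by simp [M]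
  rw [hsum, hdiag]
  by_contra! hle
  have hsq : (A k k - μ.re) ^ 2 + μ.im ^ 2 ≤ (1 - A k k) ^ 2 := by
    have h := pow_le_pow_left₀ (norm_nonneg _) hle 2
    rw [Complex.sq_norm, Complex.normSq_apply] at h
    simp at h
    nlinarith
  have hre1 : μ.re = 1 := by nlinarith [sq_nonneg μ.im]
  have him : μ.im = 0 := by rw [hre1] at hsq; nlinarith
  exact h1 (Complex.ext hre1 him)

end DirichletForm

/-! ### A deterministic convergence lemma -/

/-- If a sequence has bounded increments and the squares `(z n / n) ^ 2` are summable with the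
weights `1 / n`, then `z n / n → 0`: wherever `|z n|` is large, it remains of the same order along
a time interval of length proportional to `|z n|`. -/
lemma tendsto_div_of_summable_sq {z : ℕ → ℝ} {L : ℝ} (hL : ∀ n, |z (n + 1) - z n| ≤ L)
    (hs : Summable fun n : ℕ => z n ^ 2 / (((n : ℝ) + 2) * (n + 3) * (n + 4))) :
    Tendsto (fun n : ℕ => z n / ((n : ℝ) + 1)) atTop (𝓝 0) := by
  -- `K` bounds both the increments and the first member, hence `|z n| ≤ K (n + 1)`.
  obtain ⟨K, hK0, hKL, hKz⟩ : ∃ K : ℝ, 0 < K ∧ L ≤ K ∧ |z 0| ≤ K :=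
    ⟨|L| + |z 0| + 1, by positivity, by linarith [le_abs_self L, abs_nonneg (z 0)],
      by linarith [abs_nonneg L]⟩
  have hlin : ∀ n : ℕ, |z n| ≤ K * (n + 1) := by
    intro n
    induction n with
    | zero => simpa using hKz
    | succ n ih =>
      have := hL n
      have h2 : |z (n + 1)| ≤ |z (n + 1) - z n| + |z n| := by
        simpa using abs_add_le (z (n + 1) - z n) (z n)
      push_cast
      nlinarith
  have hnear : ∀ n j : ℕ, |z n| - K * j ≤ |z (n + j)| := by
    intro n j
    induction j with
    | zero => simp
    | succ j ih =>
      have := hL (n + j)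
      have h2 : |z (n + j)| ≤ |z (n + j + 1) - z (n + j)| + |z (n + j + 1)| := by
        rw [abs_sub_comm]
        simpa using abs_add_le (z (n + j) - z (n + j + 1)) (z (n + j + 1))
      rw [← add_assoc]
      push_cast
      linarith
  set f : ℕ → ℝ := fun n => z n ^ 2 / (((n : ℝ) + 2) * (n + 3) * (n + 4)) with hf
  have hf0 : ∀ n, 0 ≤ f n := fun n => by positivity
  have htail : Tendsto (fun n => ∑' k, f (k + n)) atTop (𝓝 0) := tendsto_sum_nat_add f
  have hbound : ∀ n : ℕ, |z n / ((n : ℝ) + 1)| ^ 3 ≤ (1000 * K) * ∑' k, f (k + n) := by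
    intro n
    set p : ℕ := ⌊|z n| / (2 * K)⌋₊ with hp
    have hp1 : (p : ℝ) ≤ |z n| / (2 * K) := Nat.floor_le (by positivity)
    have hp2 : |z n| / (2 * K) ≤ p + 1 := (Nat.lt_floor_add_one _).le
    have hpn : (p : ℝ) ≤ n + 1 := by
      refine hp1.trans ?_
      rw [div_le_iff₀ (by positivity)]
      nlinarith [hlin n]
    have hpK : K * p ≤ |z n| / 2 := by
      rw [le_div_iff₀ (by positivity)] at hp1
      linarith
    have hterm : ∀ j ∈ Finset.range (p + 1), (z n ^ 2 / 4) / (5 * ((n : ℝ) + 1)) ^ 3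
        ≤ f (j + n) := by
      intro j hj
      have hjp : (j : ℝ) ≤ p := by
        exact_mod_cast Nat.lt_succ_iff.1 (Finset.mem_range.1 hj)
      have h1 : |z n| / 2 ≤ |z (j + n)| := by
        have := hnear n j
        rw [add_comm j n]
        nlinarith
      have h2 : z n ^ 2 / 4 ≤ z (j + n) ^ 2 := by
        rw [← sq_abs (z n), ← sq_abs (z (j + n))]
        nlinarith [abs_nonneg (z n)]
      have hn0 : (0 : ℝ) ≤ n := Nat.cast_nonneg n
      have hj0 : (0 : ℝ) ≤ j := Nat.cast_nonneg j
      have h3 : (((j + n : ℕ) : ℝ) + 2) * ((j + n : ℕ) + 3) * ((j + n : ℕ) + 4)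
          ≤ (5 * ((n : ℝ) + 1)) ^ 3 := by
        push_cast
        rw [pow_succ, sq]
        gcongr <;> linarith
      exact div_le_div₀ (sq_nonneg _) h2 (by positivity) h3
    have hsum : ((p : ℝ) + 1) * ((z n ^ 2 / 4) / (5 * ((n : ℝ) + 1)) ^ 3)
        ≤ ∑' k, f (k + n) := by
      have h1 := Finset.card_nsmul_le_sum (Finset.range (p + 1)) (fun j => f (j + n)) _ hterm
      rw [Finset.card_range, nsmul_eq_mul] at h1
      push_cast at h1
      refine h1.trans (Summable.sum_le_tsum _ (fun j _ => hf0 _) ?_)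
      exact (summable_nat_add_iff n).2 hs
    have hn1 : (0 : ℝ) < n + 1 := by positivity
    calc |z n / ((n : ℝ) + 1)| ^ 3
        = (1000 * K) * (|z n| / (2 * K) * ((z n ^ 2 / 4) / (5 * ((n : ℝ) + 1)) ^ 3)) := by
          rw [abs_div, abs_of_pos hn1, ← sq_abs (z n)]
          field_simp
          ring
      _ ≤ (1000 * K) * (((p : ℝ) + 1) * ((z n ^ 2 / 4) / (5 * ((n : ℝ) + 1)) ^ 3)) := by
          gcongr
      _ ≤ _ := by gcongr
  have h3 : Tendsto (fun n : ℕ => |z n / ((n : ℝ) + 1)| ^ 3) atTop (𝓝 0) := by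
    refine squeeze_zero (fun n => by positivity) hbound ?_
    simpa using htail.const_mul (1000 * K)
  rw [Metric.tendsto_atTop] at h3 ⊢
  intro ε hε
  obtain ⟨N, hN⟩ := h3 (ε ^ 3) (by positivity)
  refine ⟨N, fun n hn => ?_⟩
  have := hN n hn
  rw [Real.dist_eq, sub_zero, abs_of_nonneg (by positivity)] at this
  rw [Real.dist_eq, sub_zero]
  exact lt_of_pow_lt_pow_left₀ 3 hε.le this

/-! ### The replacement matrix and its left eigenvector -/

lemma replacementMatrix_apply (m : ℕ) (i j : Fin (2 * m - 2)) :
    replacementMatrix m i j = replacementEntry m (i + 1) (j + 1) := rfl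

lemma sum_fin_eq_sum_Icc (n : ℕ) (f : ℕ → ℝ) :
    ∑ i : Fin n, f (i + 1) = ∑ c ∈ Finset.Icc 1 n, f c := by
  rw [← Finset.sum_range fun i => f (i + 1), Finset.range_eq_Ico, Finset.sum_Ico_add' f 0 n 1]
  rfl

lemma replacementMatrix_nonneg {m : ℕ} {i j : Fin (2 * m - 2)} (hij : i ≠ j) :
    0 ≤ replacementMatrix m i j := by
  rw [replacementMatrix_apply]
  have : (i : ℕ) ≠ j := fun h => hij (Fin.ext h)
  have h : 0 ≤ replacementEntry m (i + 1) (j + 1) := by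
    simp only [replacementEntry]
    grind
  exact_mod_cast h

lemma sum_replacementMatrix {m : ℕ} (hm : 2 ≤ m) (i : Fin (2 * m - 2)) :
    ∑ j, replacementMatrix m i j = 1 := by
  simp only [replacementMatrix_apply]
  rw [sum_fin_eq_sum_Icc (2 * m - 2) fun c => (replacementEntry m (i + 1) c : ℝ)]
  have hi := i.2
  have h : ∑ c ∈ Finset.Icc 1 (2 * m - 2), replacementEntry m (i + 1) c = 1 := by
    simp only [replacementEntry, Nat.add_right_cancel_iff]
    split_ifs with h
    · simp only [Finset.sum_add_distrib, Finset.sum_ite_eq', Finset.mem_Icc]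
      simp only [leafColor]
      grind
    · simp only [Finset.sum_add_distrib, Finset.sum_ite_eq', Finset.mem_Icc]
      simp only [leafColor]
      grind
  exact_mod_cast h

/-- The vector `limitVector` before normalization, indexed by the colors. -/
noncomputable def colorWeight (m c : ℕ) : ℝ :=
  if c ≤ m then (c : ℝ) else (m : ℝ) * (m + 1) / ((c : ℝ) - m + 2)

lemma limitVector_eq (m : ℕ) (i : Fin (2 * m - 2)) :
    limitVector m i
      = 1 / ((m : ℝ) * (m + 1) * ((harmonic m : ℝ) - 1)) * colorWeight m (i + 1) := by
  simp only [limitVector, colorWeight]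

lemma sum_Icc_cast (m : ℕ) : ∑ c ∈ Finset.Icc 1 m, (c : ℝ) = m * (m + 1) / 2 := by
  induction m with
  | zero => simp
  | succ m ih => rw [Finset.sum_Icc_succ_top (by omega), ih]; push_cast; ring

lemma sum_colorWeight (m k : ℕ) : ∑ c ∈ Finset.Icc 1 (m + k), colorWeight m c
    = (m : ℝ) * (m + 1) * ((harmonic (k + 2) : ℝ) - 1) := by
  induction k with
  | zero =>
    rw [add_zero, Finset.sum_congr rfl (g := fun c : ℕ => (c : ℝ)), sum_Icc_cast]
    · norm_num [harmonic, Finset.sum_range_succ]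
      ring
    · intro c hc
      rw [colorWeight, if_pos (Finset.mem_Icc.1 hc).2]
  | succ k ih =>
    rw [← add_assoc, Finset.sum_Icc_succ_top (by omega), ih, colorWeight, if_neg (by omega),
      show k + 1 + 2 = (k + 2) + 1 by omega, harmonic_succ (k + 2)]
    push_cast
    rw [show (m : ℝ) + k + 1 - m + 2 = k + 2 + 1 by ring]
    ring

lemma one_lt_harmonic {m : ℕ} (hm : 2 ≤ m) : (1 : ℝ) < harmonic m := by
  have h : (1 : ℚ) < harmonic m := by
    induction m, hm using Nat.le_induction with
    | base => norm_num [harmonic, Finset.sum_range_succ]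
    | succ m hm ih => rw [harmonic_succ]; linarith [show (0 : ℚ) < (↑(m + 1))⁻¹ by positivity]
  exact_mod_cast h

lemma colorWeight_pos {m c : ℕ} (hm : 2 ≤ m) (hc : 1 ≤ c) : 0 < colorWeight m c := by
  unfold colorWeight
  split_ifs with h
  · exact_mod_cast hc
  · have : (m : ℝ) < c := by exact_mod_cast not_le.1 h
    have hm0 : (0 : ℝ) < m := by positivity
    exact div_pos (by positivity) (by linarith)

lemma limitVector_pos {m : ℕ} (hm : 2 ≤ m) (i : Fin (2 * m - 2)) : 0 < limitVector m i := by
  rw [limitVector_eq]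
  have := one_lt_harmonic hm
  have hm0 : (0 : ℝ) < m := by positivity
  exact mul_pos (one_div_pos.2 (mul_pos (by positivity) (by linarith)))
    (colorWeight_pos hm (by omega))

lemma sum_limitVector {m : ℕ} (hm : 2 ≤ m) : ∑ i, limitVector m i = 1 := by
  simp only [limitVector_eq, ← Finset.mul_sum]
  rw [sum_fin_eq_sum_Icc (2 * m - 2) (colorWeight m), show 2 * m - 2 = m + (m - 2) by omega,
    sum_colorWeight, show m - 2 + 2 = m by omega]
  have := one_lt_harmonic hm
  have hm0 : (0 : ℝ) < m := by positivity
  have h0 : (m : ℝ) * (m + 1) * ((harmonic m : ℝ) - 1) ≠ 0 :=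
    (mul_pos (by positivity) (by linarith)).ne'
  rw [one_div, inv_mul_cancel₀ h0]

/-- The weights form a left eigenvector of the replacement matrix for the eigenvalue `1`. -/
lemma sum_colorWeight_mul_replacementEntry {m J : ℕ} (hm : 2 ≤ m) (h1 : 1 ≤ J)
    (hJ : J ≤ 2 * m - 2) :
    ∑ c ∈ Finset.Icc 1 (2 * m - 2), colorWeight m c * (replacementEntry m c J : ℝ)
      = colorWeight m J := by
  rcases lt_trichotomy J m with h | h | h
  · -- balls of this color are removed with the color itself and added with the next color
    have e1 : replacementEntry m J J = -(J : ℤ) := by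
      simp only [replacementEntry, leafColor]; grind
    have e2 : replacementEntry m (J + 1) J = J := by
      simp only [replacementEntry, leafColor]; grind
    have e3 : ∀ c ∈ Finset.Icc 1 (2 * m - 2), c ≠ J ∧ c ≠ J + 1 →
        colorWeight m c * (replacementEntry m c J : ℝ) = 0 := by
      intro c hc hne
      rw [Finset.mem_Icc] at hc
      have : replacementEntry m c J = 0 := by simp only [replacementEntry, leafColor]; grind
      simp [this]
    rw [Finset.sum_eq_add_of_mem J (J + 1) (by simp; omega) (by simp; omega) (by omega) e3, e1, e2,
      colorWeight, if_pos h.le, colorWeight, if_pos (by omega)]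
    push_cast
    ring
  · subst h
    rcases eq_or_lt_of_le hm with h2 | h2
    · subst h2
      simp [Finset.sum_Icc_succ_top, replacementEntry, leafColor, colorWeight]
    · have e1 : replacementEntry J J J = -(J : ℤ) := by
        simp only [replacementEntry, leafColor]; grind
      have e2 : replacementEntry J (2 * J - 2) J = J := by
        simp only [replacementEntry, leafColor]; grind
      have e3 : ∀ c ∈ Finset.Icc 1 (2 * J - 2), c ≠ J ∧ c ≠ 2 * J - 2 →
          colorWeight J c * (replacementEntry J c J : ℝ) = 0 := by
        intro c hc hne
        rw [Finset.mem_Icc] at hc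
        have : replacementEntry J c J = 0 := by simp only [replacementEntry, leafColor]; grind
        simp [this]
      rw [Finset.sum_eq_add_of_mem J (2 * J - 2) (by simp; omega) (by simp; omega) (by omega) e3,
        e1, e2, colorWeight, if_pos le_rfl, colorWeight, if_neg (by omega),
        Nat.cast_sub (by omega)]
      have hm0 : (0 : ℝ) < J := by positivity
      push_cast
      rw [show (2 : ℝ) * J - 2 - J + 2 = J by ring]
      field_simp
      ring
  · obtain ⟨k, rfl⟩ : ∃ k, J = m + (k + 1) := ⟨J - m - 1, by omega⟩
    have e1 : replacementEntry m (m + (k + 1)) (m + (k + 1)) = -(k + 2 : ℤ) := by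
      simp only [replacementEntry, leafColor]; grind
    have hk0 : (0 : ℝ) ≤ k := Nat.cast_nonneg k
    rcases Nat.eq_zero_or_pos k with h2 | h2
    · -- the first leaf color is reached from every full node
      subst h2
      have e : ∀ c ∈ Finset.Icc 1 (2 * m - 2),
          colorWeight m c * (replacementEntry m c (m + (0 + 1)) : ℝ)
            = (if c ≤ m then (c : ℝ) else 0) * 2
              + (if c = m + 1 then -2 * colorWeight m (m + 1) else 0) := by
        intro c hc
        rw [Finset.mem_Icc] at hc
        by_cases hcm : c ≤ m
        · have : replacementEntry m c (m + (0 + 1)) = 2 := by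
            simp only [replacementEntry, leafColor]; grind
          rw [this, if_pos hcm, if_neg (by omega), colorWeight, if_pos hcm]
          push_cast
          ring
        · by_cases hc1 : c = m + 1
          · subst hc1
            rw [e1]
            simp
            ring
          · have : replacementEntry m c (m + (0 + 1)) = 0 := by
              simp only [replacementEntry, leafColor]; grind
            simp [this, hcm, hc1]
      have hfil : (Finset.Icc 1 (2 * m - 2)).filter (fun c => c ≤ m) = Finset.Icc 1 m := by
        ext c; simp; omega
      rw [Finset.sum_congr rfl e, Finset.sum_add_distrib, ← Finset.sum_mul,
        ← Finset.sum_filter, hfil, sum_Icc_cast, Finset.sum_ite_eq',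
        if_pos (by simp; omega), zero_add, colorWeight, if_neg (by omega)]
      push_cast
      rw [show (m : ℝ) + 1 - m + 2 = 3 by ring]
      ring
    · have e2 : replacementEntry m (m + k) (m + (k + 1)) = (k + 2 : ℤ) := by
        simp only [replacementEntry, leafColor]; grind
      have e3 : ∀ c ∈ Finset.Icc 1 (2 * m - 2), c ≠ m + (k + 1) ∧ c ≠ m + k →
          colorWeight m c * (replacementEntry m c (m + (k + 1)) : ℝ) = 0 := by
        intro c hc hne
        rw [Finset.mem_Icc] at hc
        have : replacementEntry m c (m + (k + 1)) = 0 := by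
          simp only [replacementEntry, leafColor]; grind
        simp [this]
      rw [Finset.sum_eq_add_of_mem (m + (k + 1)) (m + k) (by simp; omega) (by simp; omega)
        (by omega) e3, e1, e2, colorWeight, if_neg (by omega), colorWeight, if_neg (by omega)]
      push_cast
      rw [show (m : ℝ) + (k + 1) - m + 2 = k + 3 by ring, show (m : ℝ) + k - m + 2 = k + 2 by ring]
      field_simp
      ring

lemma sum_limitVector_mul_replacementMatrix {m : ℕ} (hm : 2 ≤ m) (j : Fin (2 * m - 2)) :
    ∑ i, limitVector m i * replacementMatrix m i j = limitVector m j := by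
  simp only [limitVector_eq, replacementMatrix_apply, mul_assoc, ← Finset.mul_sum]
  rw [sum_fin_eq_sum_Icc (2 * m - 2) fun c => colorWeight m c * (replacementEntry m c (j + 1) : ℝ),
    sum_colorWeight_mul_replacementEntry hm (by omega) (by omega)]

/-- Consecutive colors communicate directly, in one direction or the other. -/
lemma replacementMatrix_adjacent_pos {m : ℕ} {i j : Fin (2 * m - 2)}
    (hij : (j : ℕ) = i + 1) : 0 < replacementMatrix m i j ∨ 0 < replacementMatrix m j i := by
  simp only [replacementMatrix_apply]
  have h : 0 < replacementEntry m (i + 1) (j + 1) ∨ 0 < replacementEntry m (j + 1) (i + 1) := by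
    have := j.2
    simp only [replacementEntry, leafColor, hij]
    grind
  exact_mod_cast h

/-- The Dirichlet form controls the differences of the densities at consecutive colors. -/
lemma exists_mul_sq_sub_le_dirichletForm {m : ℕ} (hm : 2 ≤ m) {i j : Fin (2 * m - 2)}
    (hij : (j : ℕ) = i + 1) : ∃ c > 0, ∀ y : Fin (2 * m - 2) → ℝ,
      c * (y j / limitVector m j - y i / limitVector m i) ^ 2
        ≤ dirichletForm (replacementMatrix m) (limitVector m) y := by
  rcases replacementMatrix_adjacent_pos hij with h | h
  · refine ⟨_, mul_pos (limitVector_pos hm i) h, fun y => ?_⟩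
    rw [← neg_sub, neg_sq]
    exact mul_sq_le_dirichletForm (limitVector_pos hm)
      (fun _ _ h => replacementMatrix_nonneg h) y i j
  · exact ⟨_, mul_pos (limitVector_pos hm j) h, fun y => mul_sq_le_dirichletForm
      (limitVector_pos hm) (fun _ _ h => replacementMatrix_nonneg h) y j i⟩

lemma isPrincipalEigenvector_limitVector {m : ℕ} (hm : 2 ≤ m) :
    IsPrincipalEigenvector (replacementMatrix m).transpose 1 (limitVector m) := by
  have hv := limitVector_pos hm
  have hA : ∀ i j, i ≠ j → 0 ≤ replacementMatrix m i j := fun _ _ h => replacementMatrix_nonneg h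
  refine ⟨?_, ?_, fun w hw => ?_, fun μ hμ h1 => ?_⟩
  · intro h
    exact (hv ⟨0, by omega⟩).ne' (congrFun h _)
  · funext j
    rw [one_smul, ← sum_limitVector_mul_replacementMatrix hm j]
    show ∑ i, replacementMatrix m i j * limitVector m i = _
    exact Finset.sum_congr rfl fun i _ => mul_comm (replacementMatrix m i j) (limitVector m i)
  · -- the Dirichlet form of a left eigenvector vanishes, hence its density is constant
    have hcol : ∀ j, ∑ i, w i * replacementMatrix m i j = w j := by
      intro j
      have := congrFun hw j
      rw [one_smul] at this
      rw [← this]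
      exact Finset.sum_congr rfl fun i _ => mul_comm (w i) (replacementMatrix m i j)
    have hB := sum_mul_mul_div_eq (replacementMatrix m) hv (sum_replacementMatrix hm)
      (sum_limitVector_mul_replacementMatrix hm) w
    have hV : ∑ i, ∑ j, w i * replacementMatrix m i j * w j / limitVector m j
        = weightedSq (limitVector m) w := by
      rw [Finset.sum_comm]
      refine Finset.sum_congr rfl fun j _ => ?_
      rw [← Finset.sum_div, ← Finset.sum_mul, hcol, sq]
    have hD : dirichletForm (replacementMatrix m) (limitVector m) w = 0 := by linarith
    have hconst : ∀ (k : ℕ) (hk : k < 2 * m - 2),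
        w ⟨k, hk⟩ / limitVector m ⟨k, hk⟩ = w ⟨0, by omega⟩ / limitVector m ⟨0, by omega⟩ := by
      intro k
      induction k with
      | zero => intro _; rfl
      | succ k ih =>
        intro hk
        rw [← ih (by omega)]
        obtain ⟨c, hc, h⟩ := exists_mul_sq_sub_le_dirichletForm hm
          (i := ⟨k, by omega⟩) (j := ⟨k + 1, hk⟩) rfl
        have h' := h w
        rw [hD] at h'
        have h0 : (w ⟨k + 1, hk⟩ / limitVector m ⟨k + 1, hk⟩
            - w ⟨k, by omega⟩ / limitVector m ⟨k, by omega⟩) ^ 2 = 0 :=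
          le_antisymm (nonpos_of_mul_nonpos_right h' hc) (sq_nonneg _)
        linarith [pow_eq_zero_iff (two_ne_zero) |>.1 h0]
    refine ⟨w ⟨0, by omega⟩ / limitVector m ⟨0, by omega⟩, ?_⟩
    funext i
    rw [Pi.smul_apply, smul_eq_mul, ← hconst i i.2, div_mul_cancel₀ _ (hv i).ne']
  · rw [Complex.ofReal_one] at h1
    exact re_lt_one_of_hasEigenvalue_transpose hA (sum_replacementMatrix hm) hμ h1

/-! ### The mean energy of the gaps -/

namespace MaryTree

/-- The mean of `G` at the vector of gap numbers of the tree that is grown from a uniformly random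
permutation of `n + 1` keys. -/
noncomputable def permMean (m n : ℕ) (G : (Fin (2 * m - 2) → ℝ) → ℝ) : ℝ :=
  (∑ ρ : Equiv.Perm (Fin (n + 1)), G (gapVector m (permSeq ρ) (n + 1))) / ((n + 1).factorial : ℝ)

lemma permMean_nonneg {m n : ℕ} {G : (Fin (2 * m - 2) → ℝ) → ℝ} (hG : ∀ y, 0 ≤ G y) :
    0 ≤ permMean m n G :=
  div_nonneg (Finset.sum_nonneg fun _ _ => hG _) (Nat.cast_nonneg _)

lemma permMean_weightedSq_succ_le {m : ℕ} (hm : 2 ≤ m) (n : ℕ) :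
    permMean m (n + 1) (weightedSq (limitVector m))
      ≤ ((n + 4) * permMean m n (weightedSq (limitVector m))
          - permMean m n (dirichletForm (replacementMatrix m) (limitVector m))) / (n + 2)
        + ∑ i, weightedSq (limitVector m) (replacementMatrix m i) := by
  set v := limitVector m
  set A := replacementMatrix m
  set K := ∑ i, weightedSq v (A i) with hK
  have hv : ∀ i, 0 < v i := limitVector_pos hm
  have hstep : ∀ ρ : Equiv.Perm (Fin (n + 1)),
      ∑ i, gapVector m (permSeq ρ) (n + 1) i * weightedSq v (gapVector m (permSeq ρ) (n + 1) + A i)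
        ≤ (n + 4) * weightedSq v (gapVector m (permSeq ρ) (n + 1))
          - dirichletForm A v (gapVector m (permSeq ρ) (n + 1)) + (n + 2) * K := by
    intro ρ
    have hsum := sum_gapVector hm (injOn_permSeq ρ)
    rw [sum_mul_weightedSq_add A hv (sum_replacementMatrix hm)
      (sum_limitVector_mul_replacementMatrix hm), hsum]
    have hle : ∑ i, gapVector m (permSeq ρ) (n + 1) i * weightedSq v (A i) ≤ (n + 2) * K := by
      rw [← hsum, Finset.sum_mul]
      refine Finset.sum_le_sum fun i _ => mul_le_mul_of_nonneg_left ?_ (gapVector_nonneg _ _ i)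
      exact Finset.single_le_sum (f := fun i => weightedSq v (A i))
        (fun i _ => weightedSq_nonneg hv _) (Finset.mem_univ i)
    linarith
  have hfac : (0 : ℝ) < ((n + 1).factorial : ℝ) := by positivity
  have htot := Finset.sum_le_sum (s := Finset.univ) fun ρ _ => hstep ρ
  rw [← sum_perm_gapVector_succ hm n (weightedSq v), Finset.sum_add_distrib,
    Finset.sum_sub_distrib, ← Finset.mul_sum, Finset.sum_const, Finset.card_univ,
    Fintype.card_perm, Fintype.card_fin, nsmul_eq_mul] at htot
  unfold permMean
  rw [Nat.factorial_succ (n + 1)]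
  push_cast
  rw [div_le_iff₀ (by positivity)]
  refine htot.trans (le_of_eq ?_)
  field_simp
  ring

/-- The mean energies are summable with the weights `1 / n ^ 3`, because they are the losses in
the recursion for the mean of the weighted norm. -/
lemma summable_permMean_dirichletForm {m : ℕ} (hm : 2 ≤ m) :
    Summable fun n : ℕ => permMean m n (dirichletForm (replacementMatrix m) (limitVector m))
      / (((n : ℝ) + 2) * (n + 3) * (n + 4)) := by
  set a := fun n => permMean m n (weightedSq (limitVector m)) with ha
  set d := fun n => permMean m n (dirichletForm (replacementMatrix m) (limitVector m)) with hd
  set K := ∑ i, weightedSq (limitVector m) (replacementMatrix m i) with hK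
  have hv := limitVector_pos hm
  have ha0 : ∀ n, 0 ≤ a n := fun n => permMean_nonneg (weightedSq_nonneg hv)
  have hd0 : ∀ n, 0 ≤ d n := fun n =>
    permMean_nonneg (dirichletForm_nonneg hv fun _ _ h => replacementMatrix_nonneg h)
  have hK0 : 0 ≤ K := Finset.sum_nonneg fun i _ => weightedSq_nonneg hv _
  -- the potential whose decrease dominates the energy
  set w : ℕ → ℝ := fun n => a n / (((n : ℝ) + 2) * (n + 3)) + K / (n + 3) with hw
  have hw0 : ∀ n, 0 ≤ w n := fun n =>
    add_nonneg (div_nonneg (ha0 n) (by positivity)) (div_nonneg hK0 (by positivity))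
  have hstep : ∀ n : ℕ, d n / (((n : ℝ) + 2) * (n + 3) * (n + 4)) ≤ w n - w (n + 1) := by
    intro n
    have h : a (n + 1) ≤ ((n + 4) * a n - d n) / (n + 2) + K := permMean_weightedSq_succ_le hm n
    have h' : a (n + 1) / (((n : ℝ) + 3) * (n + 4))
        ≤ (((n + 4) * a n - d n) / (n + 2) + K) / (((n : ℝ) + 3) * (n + 4)) := by gcongr
    have e : (((n + 4) * a n - d n) / (n + 2) + K) / (((n : ℝ) + 3) * (n + 4))
        = w n - K / (n + 4) - d n / (((n : ℝ) + 2) * (n + 3) * (n + 4)) := by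
      simp only [hw]
      field_simp
      ring
    have e' : w (n + 1) = a (n + 1) / (((n : ℝ) + 3) * (n + 4)) + K / (n + 4) := by
      simp only [hw]
      push_cast
      ring_nf
    linarith
  refine summable_of_sum_range_le (c := w 0) (fun n => div_nonneg (hd0 n) (by positivity)) ?_
  intro N
  refine (Finset.sum_le_sum fun n _ => hstep n).trans ?_
  rw [Finset.sum_range_sub']
  linarith [hw0 N]

end MaryTree

/-! ### The random permutation model -/

lemma perm_eq_of_strictMono {n : ℕ} {x : Fin n → ℝ} {σ τ : Equiv.Perm (Fin n)}
    (h1 : StrictMono fun k => x (σ k)) (h2 : StrictMono fun k => x (τ k)) : σ = τ := by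
  have hinj : Function.Injective x := by
    intro a b hab
    have : σ.symm a = σ.symm b := h1.injective (by simpa using hab)
    exact σ.symm.injective this
  have e1 := Tuple.unique_monotone (f := x) (σ := σ) (τ := τ) h1.monotone h2.monotone
  ext k
  exact congrArg Fin.val (hinj (congrFun e1 k))

section Model

variable {Ω : Type*} {U : ℕ → Ω → ℝ}

/-- The event that `σ` sorts the first `n` keys. -/
def sortEvent (U : ℕ → Ω → ℝ) {n : ℕ} (σ : Equiv.Perm (Fin n)) : Set Ω :=
  {ω | StrictMono fun k : Fin n => U (σ k) ω}

lemma eq_of_mem_sortEvent {n : ℕ} {σ τ : Equiv.Perm (Fin n)} {ω : Ω} (h1 : ω ∈ sortEvent U σ)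
    (h2 : ω ∈ sortEvent U τ) : σ = τ :=
  perm_eq_of_strictMono (x := fun k : Fin n => U k ω) h1 h2

lemma MaryTree.gapVector_of_mem_sortEvent (m : ℕ) {n : ℕ} {σ : Equiv.Perm (Fin (n + 1))} {ω : Ω}
    (h : ω ∈ sortEvent U σ) :
    gapVector m (fun k => U k ω) (n + 1) = gapVector m (permSeq σ⁻¹) (n + 1) := by
  refine gapVector_eq_of_strictMono (f := fun k => U (σ k) ω) h fun i hi => ?_
  simp [permSeq_of_lt _ hi]

variable [MeasurableSpace Ω] {P : Measure Ω}

lemma measurableSet_sortEvent (hU : ∀ k, Measurable (U k)) {n : ℕ} (σ : Equiv.Perm (Fin n)) :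
    MeasurableSet (sortEvent U σ) := by
  have : sortEvent U σ = ⋂ i, ⋂ j, ⋂ (_ : i < j), {ω | U (σ i) ω < U (σ j) ω} := by
    ext x; simp [sortEvent, StrictMono]
  rw [this]
  exact MeasurableSet.iInter fun i => MeasurableSet.iInter fun j =>
    MeasurableSet.iInter fun _ => measurableSet_lt (hU _) (hU _)

lemma measure_sortEvent (hU : IsRandomPermutationModel P U) {n : ℕ} (σ : Equiv.Perm (Fin n)) :
    P (sortEvent U σ) = (n.factorial : ENNReal)⁻¹ := hU.2 n σ

lemma ae_exists_mem_sortEvent [IsProbabilityMeasure P] (hU : IsRandomPermutationModel P U)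
    (n : ℕ) : ∀ᵐ ω ∂P, ∃ σ : Equiv.Perm (Fin n), ω ∈ sortEvent U σ := by
  have hmeas := fun σ : Equiv.Perm (Fin n) => measurableSet_sortEvent hU.1 σ
  have h : P (⋃ σ : Equiv.Perm (Fin n), sortEvent U σ) = 1 := by
    rw [measure_iUnion (fun σ τ hne => Set.disjoint_left.2 fun ω h1 h2 =>
      hne (eq_of_mem_sortEvent h1 h2)) hmeas, tsum_fintype,
      Finset.sum_congr rfl fun σ _ => measure_sortEvent hU σ]
    simp only [Finset.sum_const, Finset.card_univ, Fintype.card_perm, Fintype.card_fin,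
      nsmul_eq_mul]
    exact ENNReal.mul_inv_cancel (by simp [Nat.factorial_ne_zero]) (ENNReal.natCast_ne_top _)
  have h' := (prob_compl_eq_zero_iff (MeasurableSet.iUnion hmeas)).2 h
  rw [ae_iff]
  convert h' using 2
  ext ω
  simp

lemma ae_injective [IsProbabilityMeasure P] (hU : IsRandomPermutationModel P U) :
    ∀ᵐ ω ∂P, Function.Injective fun k => U k ω := by
  filter_upwards [ae_all_iff.2 fun n => ae_exists_mem_sortEvent hU n] with ω hω
  intro i j hij
  obtain ⟨σ, hσ⟩ := hω (max i j + 1)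
  have hi : i < max i j + 1 := by omega
  have hj : j < max i j + 1 := by omega
  have h : σ.symm ⟨i, hi⟩ = σ.symm ⟨j, hj⟩ := hσ.injective (by simpa using hij)
  exact congrArg Fin.val (σ.symm.injective h)

namespace MaryTree

lemma gapVector_ae_eq_sum_indicator [IsProbabilityMeasure P] (hU : IsRandomPermutationModel P U)
    (m n : ℕ) (G : (Fin (2 * m - 2) → ℝ) → ENNReal) :
    (fun ω => G (gapVector m (fun k => U k ω) (n + 1))) =ᵐ[P]
      fun ω => ∑ σ : Equiv.Perm (Fin (n + 1)), (sortEvent U σ).indicator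
        (fun _ => G (gapVector m (permSeq σ⁻¹) (n + 1))) ω := by
  filter_upwards [ae_exists_mem_sortEvent hU (n + 1)] with ω ⟨σ, hσ⟩
  rw [Finset.sum_eq_single σ]
  · rw [Set.indicator_of_mem hσ, gapVector_of_mem_sortEvent m hσ]
  · intro τ _ hne
    exact Set.indicator_of_notMem (fun h => hne (eq_of_mem_sortEvent h hσ)) _
  · simp

lemma aemeasurable_gapVector [IsProbabilityMeasure P] (hU : IsRandomPermutationModel P U)
    (m n : ℕ) (G : (Fin (2 * m - 2) → ℝ) → ENNReal) :
    AEMeasurable (fun ω => G (gapVector m (fun k => U k ω) (n + 1))) P :=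
  ⟨_, Finset.measurable_fun_sum _ fun σ _ => measurable_const.indicator
    (measurableSet_sortEvent hU.1 σ), gapVector_ae_eq_sum_indicator hU m n G⟩

lemma lintegral_gapVector [IsProbabilityMeasure P] (hU : IsRandomPermutationModel P U)
    (m n : ℕ) {G : (Fin (2 * m - 2) → ℝ) → ℝ} (hG : ∀ y, 0 ≤ G y) :
    ∫⁻ ω, ENNReal.ofReal (G (gapVector m (fun k => U k ω) (n + 1))) ∂P
      = ENNReal.ofReal (permMean m n G) := by
  rw [lintegral_congr_ae (gapVector_ae_eq_sum_indicator hU m n fun y => ENNReal.ofReal (G y)),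
    lintegral_finsetSum _ fun σ _ => measurable_const.indicator (measurableSet_sortEvent hU.1 σ)]
  simp only [lintegral_indicator_const (measurableSet_sortEvent hU.1 _),
    measure_sortEvent hU]
  rw [← Finset.sum_mul, permMean, ENNReal.ofReal_div_of_pos (by positivity),
    ENNReal.ofReal_sum_of_nonneg fun _ _ => hG _, ENNReal.ofReal_natCast, div_eq_mul_inv]
  congr 1
  exact Equiv.sum_comp (Equiv.inv (Equiv.Perm (Fin (n + 1))))
    fun ρ => ENNReal.ofReal (G (gapVector m (permSeq ρ) (n + 1)))

/-- Almost surely, the energy of the gap numbers is summable with the weights `1 / n ^ 3`. -/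
lemma ae_summable_dirichletForm [IsProbabilityMeasure P] (hU : IsRandomPermutationModel P U)
    {m : ℕ} (hm : 2 ≤ m) :
    ∀ᵐ ω ∂P, Summable fun n : ℕ =>
      dirichletForm (replacementMatrix m) (limitVector m) (gapVector m (fun k => U k ω) (n + 1))
        / (((n : ℝ) + 2) * (n + 3) * (n + 4)) := by
  set D := dirichletForm (replacementMatrix m) (limitVector m)
  have hD : ∀ y, 0 ≤ D y :=
    dirichletForm_nonneg (limitVector_pos hm) fun _ _ h => replacementMatrix_nonneg h
  let F : ℕ → (Fin (2 * m - 2) → ℝ) → ℝ := fun n y => D y / (((n : ℝ) + 2) * (n + 3) * (n + 4))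
  have hF : ∀ n y, 0 ≤ F n y := fun n y => div_nonneg (hD y) (by positivity)
  have hmean : ∀ n : ℕ, permMean m n (F n)
      = permMean m n D / (((n : ℝ) + 2) * (n + 3) * (n + 4)) := by
    intro n
    simp only [permMean, F, ← Finset.sum_div]
    exact div_right_comm _ _ _
  have hmeas : ∀ n, AEMeasurable
      (fun ω => ENNReal.ofReal (F n (gapVector m (fun k => U k ω) (n + 1)))) P :=
    fun n => aemeasurable_gapVector hU m n fun y => ENNReal.ofReal (F n y)
  have hfin : ∫⁻ ω, ∑' n, ENNReal.ofReal (F n (gapVector m (fun k => U k ω) (n + 1))) ∂P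
      ≠ ⊤ := by
    rw [lintegral_tsum hmeas]
    simp only [lintegral_gapVector hU m _ (hF _), hmean]
    exact (summable_permMean_dirichletForm hm).tsum_ofReal_ne_top
  filter_upwards [ae_lt_top' (AEMeasurable.tsum hmeas) hfin] with ω hω
  have h := ENNReal.summable_toReal hω.ne
  refine h.congr fun n => ?_
  rw [ENNReal.toReal_ofReal (hF _ _)]

/-! ### Convergence of the proportions of gaps -/

lemma gapType_le {m : ℕ} {α : Type*} (g : ℕ) (p : α → Bool) (t : MaryTree m α) :
    gapType g p t ≤ max g (2 * m) := by
  induction t generalizing g with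
  | empty => exact le_max_left _ _
  | node keys ch ih =>
    rw [gapType]
    split_ifs
    · omega
    · have := emptyCount_le ch
      refine (ih _ _).trans ?_
      omega
    · omega

lemma abs_gapVector_succ_sub_le {m : ℕ} (hm : 2 ≤ m) {α : Type*} [LinearOrder α] {x : ℕ → α}
    (hx : Function.Injective x) (n : ℕ) (i : Fin (2 * m - 2)) :
    |gapVector m x (n + 2) i - gapVector m x (n + 1) i| ≤ 8 * m + 8 := by
  rw [gapVector_succ hm hx.injOn, add_sub_cancel_left]
  have hc := gapType_le 0 (fun k => decide (k ≤ x (n + 1))) (grow m x (n + 1))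
  rw [max_eq_right (Nat.zero_le _)] at hc
  generalize gapType 0 (fun k => decide (k ≤ x (n + 1))) (grow m x (n + 1)) = c at hc
  have h : |replacementEntry m c (i + 1)| ≤ 8 * m + 8 := by
    rw [abs_le]
    simp only [replacementEntry]
    grind
  exact_mod_cast h

lemma tendsto_gapVector_div {m : ℕ} (hm : 2 ≤ m) {x : ℕ → ℝ} (hx : Function.Injective x)
    (hs : Summable fun n : ℕ =>
      dirichletForm (replacementMatrix m) (limitVector m) (gapVector m x (n + 1))
        / (((n : ℝ) + 2) * (n + 3) * (n + 4))) (i : Fin (2 * m - 2)) :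
    Tendsto (fun n : ℕ => gapVector m x n i / n) atTop (𝓝 (limitVector m i)) := by
  set v := limitVector m with hvdef
  have hv : ∀ i, 0 < v i := limitVector_pos hm
  -- the densities of the gap numbers with respect to `v`
  set h : ℕ → Fin (2 * m - 2) → ℝ := fun n i => gapVector m x (n + 1) i / v i with hh
  have hadj : ∀ a b : Fin (2 * m - 2), (b : ℕ) = a + 1 →
      Tendsto (fun n : ℕ => (h n b - h n a) / ((n : ℝ) + 1)) atTop (𝓝 0) := by
    intro a b hab
    have hinc : ∀ n, |(h (n + 1) b - h (n + 1) a) - (h n b - h n a)|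
        ≤ (8 * m + 8) / v b + (8 * m + 8) / v a := by
      intro n
      have e : ∀ c, |h (n + 1) c - h n c| ≤ (8 * m + 8) / v c := by
        intro c
        simp only [hh, ← sub_div, abs_div, abs_of_pos (hv c)]
        exact div_le_div_of_nonneg_right (abs_gapVector_succ_sub_le hm hx n c) (hv c).le
      rw [sub_sub_sub_comm]
      exact (abs_sub _ _).trans (add_le_add (e b) (e a))
    refine tendsto_div_of_summable_sq hinc ?_
    obtain ⟨c, hc, hle⟩ := exists_mul_sq_sub_le_dirichletForm hm hab
    refine Summable.of_nonneg_of_le (fun n => by positivity) (fun n => ?_) (hs.mul_left c⁻¹)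
    rw [← mul_div_assoc]
    refine div_le_div_of_nonneg_right ?_ (by positivity)
    rw [inv_mul_eq_div, le_div_iff₀ hc, mul_comm]
    exact hle _
  let o : Fin (2 * m - 2) := ⟨0, by omega⟩
  have hall : ∀ (k : ℕ) (hk : k < 2 * m - 2),
      Tendsto (fun n : ℕ => (h n ⟨k, hk⟩ - h n o) / ((n : ℝ) + 1)) atTop (𝓝 0) := by
    intro k
    induction k with
    | zero => intro hk; simp [o]
    | succ k ih =>
      intro hk
      have h1 := (hadj ⟨k, by omega⟩ ⟨k + 1, hk⟩ rfl).add (ih (by omega))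
      rw [add_zero] at h1
      refine h1.congr fun n => ?_
      ring
  have hratio : Tendsto (fun n : ℕ => ((n : ℝ) + 2) / ((n : ℝ) + 1)) atTop (𝓝 1) := by
    have h1 := tendsto_one_div_add_atTop_nhds_zero_nat (𝕜 := ℝ).const_add 1
    rw [add_zero] at h1
    refine h1.congr fun n => ?_
    field_simp
    ring
  -- the total number of gaps determines the common limit of the densities
  have ho : Tendsto (fun n : ℕ => h n o / ((n : ℝ) + 1)) atTop (𝓝 1) := by
    have h1 : Tendsto (fun n : ℕ => ∑ k, v k * ((h n k - h n o) / ((n : ℝ) + 1))) atTop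
        (𝓝 (∑ k : Fin (2 * m - 2), v k * 0)) :=
      tendsto_finsetSum _ fun k _ => (hall k k.2).const_mul (v k)
    have h2 := hratio.sub h1
    simp only [mul_zero, Finset.sum_const_zero, sub_zero] at h2
    refine h2.congr fun n => ?_
    have e1 : ∑ k, v k * h n k = n + 2 := by
      rw [← sum_gapVector hm (hx.injOn (s := Set.Iio (n + 1)))]
      exact Finset.sum_congr rfl fun k _ => mul_div_cancel₀ _ (hv k).ne'
    have e2 : ∑ k, v k * ((h n k - h n o) / ((n : ℝ) + 1))
        = (∑ k, v k * h n k - (∑ k, v k) * h n o) / ((n : ℝ) + 1) := by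
      rw [Finset.sum_mul, ← Finset.sum_sub_distrib, Finset.sum_div]
      exact Finset.sum_congr rfl fun k _ => by ring
    rw [e2, e1, hvdef, sum_limitVector hm]
    ring
  rw [← tendsto_add_atTop_iff_nat 1]
  have h3 := ((hall i i.2).add ho).const_mul (v i)
  rw [zero_add, mul_one] at h3
  refine h3.congr fun n => ?_
  have := (hv i).ne'
  simp only [hh]
  push_cast
  field_simp
  ring

end MaryTree

end Model

theorem mainTheorem3 (m : ℕ) (hm : 2 ≤ m)
    {Ω : Type*} [MeasurableSpace Ω] (P : Measure Ω) [IsProbabilityMeasure P]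
    (U : ℕ → Ω → ℝ) (hU : IsRandomPermutationModel P U) :
    IsPrincipalEigenvector (replacementMatrix m).transpose 1 (limitVector m) ∧
    ∑ i, limitVector m i = 1 ∧
    ∀ᵐ ω ∂P, ∀ i : Fin (2 * m - 2),
      Tendsto
        (fun n : ℕ => ((MaryTree.grow m (fun k => U k ω) n).gapCount (i + 1) : ℝ) / n)
        atTop (𝓝 (limitVector m i)) := by
  refine ⟨isPrincipalEigenvector_limitVector hm, sum_limitVector hm, ?_⟩
  filter_upwards [ae_injective hU, MaryTree.ae_summable_dirichletForm hU hm] with ω h1 h2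
  exact MaryTree.tendsto_gapVector_div hm h1 h2
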